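/- Consider a system of $N\ge 1$ agents labelled $1,\dots,N$ on the time interval $[0,\infty)$. Agent $i$ holds a piecewise constant value $x_i(t)$. The replacements of each agent follow a Poisson clock of rate $\lambda_r>0$; at each replacement of $i$, a new value is drawn for $i$ and everything $i$ knew is erased. All (initial and new) values are i.i.d. with mean $0$ and variance $\sigma^2$. Agents also exchange information (an exchange $j\to i$ means that $j$ sends information to $i$; several exchanges may be simultaneous) at a random locally finite set of times in $(0,\infty)$, according to an arbitrary stochastic model. The replacement clocks of different agents are independent, and the replacements, the exchanges and the values are mutually independent (the exchanges need not be independent of each other). The knowledge set $\mathcal K_i(t)$ is initialized at every arrival time $t_0$ of $i$ (time $0$ or a replacement of $i$) as $\{(x_i(t_0),i,t_0)\}$, and at every time $\tau$ at which exchanges $j\to i$ take place it becomes $$\mathcal K_i(\tau^+)=\mathcal K_i(\tau^-)\cup\bigcup_{j:\,j\to i\text{ at }\tau}\Big(\mathcal K_j(\tau^-)\cup\{(x_j(\tau),j,\tau)\}\cup\{(j\to i,\tau)\}\Big).$$ The age of the most recent information about $j$ available to $i$ at time $t$ is $T_{ji}(t)=\min\{s:(x_j(t-s),j,t-s)\in\mathcal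 K_i(t)\}$, with $T_{ji}(t)=\infty$ if there is none. Its pseudo-CDF is $F_{ji}^t(s)=P[T_{ji}(t)\le s]$ and its pseudo-PDF is $f_{ji}^t(s)=\frac{d}{ds}F_{ji}^t(s)$. Assume that $F_{ji}^t$ is (locally) absolutely continuous on $\mathbb R$ for all $i\ne j$ and all $t>0$. Let each agent $i$ compute at each time $t\ge0$ an estimate $y_i(t)$ which is a (measurable, deterministic) function, possibly depending on $i$ and $t$, of $\mathcal K_i(t)$. Let $\bar x(t)=\frac1N\sum_i x_i(t)$ and $C(t)=\frac1N\sum_{i=1}^N(\bar x(t)-y_i(t))^2$. Suppose there is a function $f$ on $(0,\infty)$ such that, for all $i\neq j$ and all $t>0$, $f_{ji}^t(s)=f(s)$ for almost every $s\in(0,t)$. Then, for every $t\ge 0$, $$\mathbb E[C(t)]\ \ge\ \frac{N-1}{N^2}\Big(1-\int_0^t f(s)e^{-2\lambda_r s}\,ds\Big)\sigma^2 ,$$ and $$\liminf_{t\to\infty}\mathbb E[C(t)]\ \ge\ \frac{N-1}{N^2}\Big(1-\int_0^\infty f(s)e^{-2\lambda_r s}\,ds\Big)\sigma^2 ,$$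 where for $N\ge2$ the function $f(s)e^{-2\lambda_r s}$ is integrable on $(0,\infty)$ (for $N=1$ there is no condition on $f$ and the right-hand sides are $0$). The expectations may be $+\infty$. -/

import Mathlib

open MeasureTheory ProbabilityTheory Filter Set

noncomputable section

/-- A sequence of replacements and information exchanges in a system with `N` labels, together with
the values held by the agents, on the time interval `[0, ∞)`.

* `lifetime i n` is the time spent in the system by the `n`-th agent carrying label `i`
  (`n = 0` is the agent present at time `0`); it is then replaced by agent number `n + 1`.
* `value i n` is the value attributed to the `n`-th agent carrying label `i`.
* `exchTime n` (for `n = 0, 1, 2, …`) are the successive times at which exchanges may take place, and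
  `(j, i) ∈ exch n` means that agent `j` sends information to agent `i` at time `exchTime n`.
  Several exchanges may be simultaneous, and `exch n` may be empty (so that finitely many, or no,
  exchanges are possible as well). -/
structure EventSequence (N : ℕ) where
  lifetime : Fin N → ℕ → ℝ
  value : Fin N → ℕ → ℝ
  exchTime : ℕ → ℝ
  exch : ℕ → Set (Fin N × Fin N)

/-- A piece of information: either `Sum.inl (v, j, s)`, "the value of agent `j` at time `s` is `v`",
or `Sum.inr (j, i, s)`, "agent `j` sent information to agent `i` at time `s`". -/
abbrev Info (N : ℕ) : Type := (ℝ × Fin N × ℝ) ⊕ (Fin N × Fin N × ℝ)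

/-- The usual σ-algebra for random sets of pieces of information: it is generated by the events
"the set contains an element of `B`", `B` measurable. (On finite sets it is also the σ-algebra
generated by the counting maps `K ↦ #(K ∩ B)`.) -/
@[reducible]
def knowledgeSigmaAlgebra (N : ℕ) : MeasurableSpace (Set (Info N)) :=
  MeasurableSpace.generateFrom
    {S | ∃ B : Set (Info N), MeasurableSet B ∧ S = {K | (K ∩ B).Nonempty}}

namespace EventSequence

variable {N : ℕ}

/-- Time at which the `n`-th agent with label `i` enters the system (`0` for `n = 0`, and the time of
the `n`-th replacement of `i` for `n ≥ 1`). -/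
def arrival (e : EventSequence N) (i : Fin N) (n : ℕ) : ℝ :=
  ∑ k ∈ Finset.range n, e.lifetime i k

/-- Number of replacements of agent `i` up to and including time `t`. -/
def incarnation (e : EventSequence N) (i : Fin N) (t : ℝ) : ℕ :=
  sInf {n : ℕ | t < e.arrival i (n + 1)}

/-- The value `x_i(t)` held by agent `i` at time `t`. -/
def x (e : EventSequence N) (i : Fin N) (t : ℝ) : ℝ :=
  e.value i (e.incarnation i t)

/-- Time of the last arrival of agent `i` up to time `t`. -/
def lastArrival (e : EventSequence N) (i : Fin N) (t : ℝ) : ℝ :=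
  e.arrival i (e.incarnation i t)

/-- The average of the values held by the agents at time `t`. -/
def average (e : EventSequence N) (t : ℝ) : ℝ :=
  (1 / (N : ℝ)) * ∑ i, e.x i t

/-- Evolution of a knowledge set between exchanges: agent `i` holds `K` at time `s`, and no exchange
takes place in `(s, t]`. If `i` has been replaced in `(s, t]`, everything has been erased, and it only
knows its own value at its (last) arrival. -/
def carry (e : EventSequence N) (s : ℝ) (K : Set (Info N)) (i : Fin N) (t : ℝ) : Set (Info N) :=
  if s < e.lastArrival i t then
    {Sum.inl (e.x i (e.lastArrival i t), i, e.lastArrival i t)}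
  else K

/-- Initial time for `n = 0`, and the time of the `n`-th group of exchanges for `n ≥ 1`. -/
def prevTime (e : EventSequence N) : ℕ → ℝ
  | 0 => 0
  | n + 1 => e.exchTime n

/-- The knowledge sets at initialization (`n = 0`), and right after the `n`-th group of exchanges
(`n ≥ 1`). When `j` sends information to `i` at time `τ`, the set of `i` is augmented with the set of
`j` just before `τ`, with the value of `j` at time `τ`, and with the occurrence of the exchange. -/
def knowledgeAfter (e : EventSequence N) : ℕ → Fin N → Set (Info N)
  | 0 => fun i => {Sum.inl (e.x i 0, i, 0)}
  | n + 1 => fun i =>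
      let τ := e.exchTime n
      let before : Fin N → Set (Info N) := fun k =>
        e.carry (e.prevTime n) (e.knowledgeAfter n k) k τ
      before i ∪ ⋃ j ∈ {j : Fin N | (j, i) ∈ e.exch n},
        (before j ∪ {Sum.inl (e.x j τ, j, τ)} ∪ {Sum.inr (j, i, τ)})

/-- Number of groups of exchanges up to and including time `t`. -/
def exchCount (e : EventSequence N) (t : ℝ) : ℕ :=
  sInf {n : ℕ | t < e.exchTime n}

/-- The knowledge set of agent `i` at time `t` (including the effect of the events at time `t`). -/
def knowledge (e : EventSequence N) (i : Fin N) (t : ℝ) : Set (Info N) :=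
  e.carry (e.prevTime (e.exchCount t)) (e.knowledgeAfter (e.exchCount t) i) i t

/-- The age of the most recent information about agent `j` available to agent `i` at time `t`
(`⊤` if `i` has no information about `j`). -/
def age (e : EventSequence N) (j i : Fin N) (t : ℝ) : EReal :=
  sInf {a : EReal | ∃ s : ℝ, a = (s : EReal) ∧
    Sum.inl (e.x j (t - s), j, t - s) ∈ e.knowledge i t}

/-- The Mean Squared Error `C(t)` of the algorithm in which the estimate of agent `i` at time `t` is
`y_i(t) = alg i t K`, where `K` is the knowledge set of `i` at time `t`. -/
def mse (e : EventSequence N) (alg : Fin N → ℝ → Set (Info N) → ℝ) (t : ℝ) : ℝ :=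
  (1 / (N : ℝ)) * ∑ i, (e.average t - alg i t (e.knowledge i t)) ^ 2

end EventSequence

/-- The random event sequence `e` describes an open system with replacement rate `lam` and values
of mean `0` and variance `sig ^ 2`: the values are i.i.d.; the replacements of each agent follow a
Poisson clock of rate `lam` (the successive waiting times are i.i.d. exponential), and the clocks of
distinct agents are independent; the times of the exchanges are positive and locally finite, and the
law of the exchanges is otherwise arbitrary; replacements, exchanges and values are mutually
independent. -/
structure IsOpenSystem {Ω : Type*} [MeasurableSpace Ω] (μ : Measure Ω) {N : ℕ}
    (e : Ω → EventSequence N) (lam sig : ℝ) : Prop where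
  measurable_lifetime : ∀ i n, Measurable fun ω => (e ω).lifetime i n
  measurable_value : ∀ i n, Measurable fun ω => (e ω).value i n
  measurable_exchTime : ∀ n, Measurable fun ω => (e ω).exchTime n
  measurable_exch : ∀ n p, MeasurableSet {ω | p ∈ (e ω).exch n}
  lifetime_law : ∀ i n, μ.map (fun ω => (e ω).lifetime i n) = expMeasure lam
  lifetime_indep : iIndepFun (fun (p : Fin N × ℕ) ω => (e ω).lifetime p.1 p.2) μ
  value_indep : iIndepFun (fun (p : Fin N × ℕ) ω => (e ω).value p.1 p.2) μ
  value_identDistrib : ∀ p q : Fin N × ℕ,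
    IdentDistrib (fun ω => (e ω).value p.1 p.2) (fun ω => (e ω).value q.1 q.2) μ μ
  value_memLp : ∀ i n, MemLp (fun ω => (e ω).value i n) 2 μ
  value_mean : ∀ i n, ∫ ω, (e ω).value i n ∂μ = 0
  value_variance : ∀ i n, ∫ ω, (e ω).value i n ^ 2 ∂μ = sig ^ 2
  exchTime_pos : ∀ᵐ ω ∂μ, 0 < (e ω).exchTime 0
  exchTime_strictMono : ∀ᵐ ω ∂μ, StrictMono (e ω).exchTime
  exchTime_tendsto : ∀ᵐ ω ∂μ, Tendsto (e ω).exchTime atTop atTop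
  indep_replacements : IndepFun (fun ω => (e ω).lifetime)
    (fun ω => (((e ω).exchTime, (e ω).exch), (e ω).value)) μ
  indep_exchanges : IndepFun (fun ω => ((e ω).exchTime, (e ω).exch)) (fun ω => (e ω).value) μ

/-- The pseudo-CDF `s ↦ P[T_{ji}(t) ≤ s]` of the age of the most recent information about `j`
available to `i` at time `t`. -/
def pseudoCDF {Ω : Type*} [MeasurableSpace Ω] (μ : Measure Ω) {N : ℕ} (e : Ω → EventSequence N)
    (j i : Fin N) (t s : ℝ) : ℝ :=
  μ.real {ω | (e ω).age j i t ≤ (s : EReal)}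

/-- The pseudo-PDF, that is, the derivative of the pseudo-CDF. -/
def pseudoPDF {Ω : Type*} [MeasurableSpace Ω] (μ : Measure Ω) {N : ℕ} (e : Ω → EventSequence N)
    (j i : Fin N) (t s : ℝ) : ℝ :=
  deriv (pseudoCDF μ e j i t) s

end

/-! Fix an agent `i`, a time `t ≥ 0` and a label `j ≠ i`, and let `τ = latest t j i` be the time of
the last information of `i` about `j`. Exponential clocks are memoryless, so given what `i` knows,
the agent seen at `τ` is still present at `t` with probability `exp (-(lam * (t - τ)))`; otherwise
`j` holds a fresh centred value. The best guess of the value of `j` is therefore `weight` times the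
value seen at `τ`, and `0` without information: this is `prediction`.

No conditional expectation is formed. What is used is an orthogonality relation,
`integral_predictionError_mul`: the prediction error for `j` is orthogonal to every square
integrable variable that does not depend on what happens to `j` after `τ` (`Insensitive`). It rests
on causality, `AgreeUpTo.knowledgeAfter_eq`: altering the life of `j` after `τ` leaves the knowledge
of `i` unchanged. Hence one lifetime or one value of `j` may be overwritten by a constant inside all
other factors, after which it is independent of them and can be integrated out alone.

The prediction errors of `i` for distinct labels are then mutually orthogonal, and orthogonal to the
rest of its error on the sum of all values. By Pythagoras (`le_integral_sq`), the mean squared error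
on that sum is at least the sum over `j ≠ i` of `sig ^ 2 * (1 - E[weight ^ 2])`.

Finally `E[weight ^ 2]` is the expectation of `exp (-2 * lam * T)` over finite ages `T`. A
layer-cake formula expresses it through the pseudo-CDF, and integration by parts through the
pseudo-PDF (`integral_weight_sq`). For the limit, `f` is a.e. nonnegative as the derivative of a
monotone function, and the truncated integrals are at most `1`. -/

/-! ### The time of the most recent information -/

/-- The times of the pieces of information about the value of `j` contained in `K`. -/
def infoTimes {N : ℕ} (j : Fin N) (K : Set (Info N)) : Set ℝ :=
  {s | ∃ v, Sum.inl (v, j, s) ∈ K}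

/-- The most recent time, up to `t`, of a piece of information about `j` in `K`
(`-1` if there is none). -/
noncomputable def lastTime {N : ℕ} (t : ℝ) (j : Fin N) (K : Set (Info N)) : ℝ :=
  sSup (insert (-1) (infoTimes j K ∩ Iic t))

section LastTime

variable {N : ℕ} {t : ℝ} {j : Fin N} {K : Set (Info N)}

lemma bddAbove_lastTime : BddAbove (insert (-1) (infoTimes j K ∩ Iic t)) :=
  BddAbove.insert _ ⟨t, fun _ h => h.2⟩

lemma lastTime_le_iff {c : ℝ} :
    lastTime t j K ≤ c ↔ -1 ≤ c ∧ ∀ s ∈ infoTimes j K, s ≤ t → s ≤ c := by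
  unfold lastTime
  rw [csSup_le_iff bddAbove_lastTime ⟨_, mem_insert _ _⟩]
  simp only [mem_insert_iff, forall_eq_or_imp, mem_inter_iff, mem_Iic, and_imp]

lemma lastTime_le (ht : 0 ≤ t) : lastTime t j K ≤ t :=
  lastTime_le_iff.2 ⟨by linarith, fun _ _ h => h⟩

lemma le_lastTime {s : ℝ} (hs : s ∈ infoTimes j K) (hst : s ≤ t) : s ≤ lastTime t j K :=
  (lastTime_le_iff.1 le_rfl).2 s hs hst

end LastTime

/-! ### Regular sample paths and the truth of knowledge sets -/

namespace EventSequence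

variable {N : ℕ}

/-- Sample paths for which all random times behave as they almost surely do. -/
structure Regular (e : EventSequence N) : Prop where
  lifetime_pos : ∀ i n, 0 < e.lifetime i n
  arrival_tendsto : ∀ i, Tendsto (e.arrival i) atTop atTop
  exchTime_pos : 0 < e.exchTime 0
  exchTime_strictMono : StrictMono e.exchTime
  exchTime_tendsto : Tendsto e.exchTime atTop atTop

@[simp] lemma arrival_zero (e : EventSequence N) (i : Fin N) : e.arrival i 0 = 0 := by
  simp [arrival]

lemma arrival_succ (e : EventSequence N) (i : Fin N) (n : ℕ) :
    e.arrival i (n + 1) = e.arrival i n + e.lifetime i n :=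
  Finset.sum_range_succ _ _

lemma lastArrival_le (e : EventSequence N) (i : Fin N) {t : ℝ} (ht : 0 ≤ t) : e.lastArrival i t ≤ t := by
  unfold lastArrival
  rcases h : e.incarnation i t with _ | m
  · simpa using ht
  · by_contra! hlt
    have : e.incarnation i t ≤ m := Nat.sInf_le hlt
    omega

lemma prevTime_exchCount_le (e : EventSequence N) {t : ℝ} (ht : 0 ≤ t) : e.prevTime (e.exchCount t) ≤ t := by
  rcases h : e.exchCount t with _ | m
  · exact ht
  · by_contra! hlt
    have : e.exchCount t ≤ m := Nat.sInf_le hlt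
    omega

namespace Regular

variable {e : EventSequence N} (he : e.Regular)
include he

lemma arrival_strictMono (i : Fin N) : StrictMono (e.arrival i) :=
  strictMono_nat_of_lt_succ fun n => by
    rw [arrival_succ]; linarith [he.lifetime_pos i n]

lemma arrival_nonneg (i : Fin N) (n : ℕ) : 0 ≤ e.arrival i n := by
  have := (he.arrival_strictMono i).monotone (Nat.zero_le n)
  simpa using this

lemma lt_arrival_incarnation (i : Fin N) (t : ℝ) :
    t < e.arrival i (e.incarnation i t + 1) := by
  have h : {n : ℕ | t < e.arrival i (n + 1)}.Nonempty := by
    obtain ⟨n, hn⟩ := (((tendsto_add_atTop_iff_nat 1).2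
      (he.arrival_tendsto i)).eventually_gt_atTop t).exists
    exact ⟨n, hn⟩
  exact Nat.sInf_mem h

lemma lastArrival_nonneg (i : Fin N) (t : ℝ) : 0 ≤ e.lastArrival i t :=
  he.arrival_nonneg i _

lemma incarnation_eq_iff (i : Fin N) {t : ℝ} (ht : 0 ≤ t) (n : ℕ) :
    e.incarnation i t = n ↔ e.arrival i n ≤ t ∧ t < e.arrival i (n + 1) := by
  constructor
  · rintro rfl
    exact ⟨e.lastArrival_le i ht, he.lt_arrival_incarnation i t⟩
  · rintro ⟨h1, h2⟩
    apply le_antisymm (Nat.sInf_le h2)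
    by_contra! hlt
    have := (he.arrival_strictMono i).monotone (Nat.succ_le_of_lt hlt)
    exact absurd (he.lt_arrival_incarnation i t) (not_lt.2 (this.trans h1))

lemma incarnation_lt_iff (i : Fin N) {t : ℝ} (ht : 0 ≤ t) (n : ℕ) :
    e.incarnation i t < n ↔ t < e.arrival i n := by
  constructor
  · intro h
    exact (he.lt_arrival_incarnation i t).trans_le
      ((he.arrival_strictMono i).monotone (Nat.succ_le_of_lt h))
  · intro h
    by_contra! hle
    linarith [(he.arrival_strictMono i).monotone hle, ((he.incarnation_eq_iff i ht _).1 rfl).1]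

lemma exchTime_nonneg (n : ℕ) : 0 ≤ e.exchTime n :=
  he.exchTime_pos.le.trans (he.exchTime_strictMono.monotone (Nat.zero_le n))

lemma prevTime_le_exchTime (n : ℕ) : e.prevTime n ≤ e.exchTime n := by
  cases n with
  | zero => exact he.exchTime_nonneg 0
  | succ n => exact he.exchTime_strictMono.monotone (Nat.le_succ n)

end Regular

lemma carry_subset_of {e : EventSequence N} {s t : ℝ} {K A : Set (Info N)} {i : Fin N} (hK : K ⊆ A)
    (hA : Sum.inl (e.x i (e.lastArrival i t), i, e.lastArrival i t) ∈ A) :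
    e.carry s K i t ⊆ A := by
  unfold carry
  split_ifs
  · simpa using hA
  · exact hK

/-- The pieces of information about the values of the agents that are true, and not later than `t`. -/
def trueInfo (e : EventSequence N) (t : ℝ) : Set (Info N) :=
  {p | ∀ v j s, p = Sum.inl (v, j, s) → v = e.x j s ∧ 0 ≤ s ∧ s ≤ t}

lemma trueInfo_mono (e : EventSequence N) {s t : ℝ} (h : s ≤ t) : e.trueInfo s ⊆ e.trueInfo t :=
  fun _ hp v j u hu => ⟨(hp v j u hu).1, (hp v j u hu).2.1, (hp v j u hu).2.2.trans h⟩

lemma inl_mem_trueInfo (e : EventSequence N) {j : Fin N} {s t : ℝ} (h0 : 0 ≤ s) (h : s ≤ t) :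
    Sum.inl (e.x j s, j, s) ∈ e.trueInfo t := by
  intro v k u hu
  simp only [Sum.inl.injEq, Prod.mk.injEq] at hu
  obtain ⟨rfl, rfl, rfl⟩ := hu
  exact ⟨rfl, h0, h⟩

/-- Merging and erasing only ever copy records that were true when made. Truth makes the recorded
value redundant, so that `age`, which looks for the true value, can be read off the times alone. -/
lemma Regular.knowledgeAfter_subset {e : EventSequence N} (he : e.Regular) (n : ℕ) :
    ∀ i, e.knowledgeAfter n i ⊆ e.trueInfo (e.prevTime n) := by
  induction n with
  | zero =>
    intro i p hp
    rw [knowledgeAfter, mem_singleton_iff] at hp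
    subst hp
    exact e.inl_mem_trueInfo le_rfl le_rfl
  | succ n ih =>
    have hb : ∀ k, e.carry (e.prevTime n) (e.knowledgeAfter n k) k (e.exchTime n) ⊆
        e.trueInfo (e.prevTime (n + 1)) := fun k =>
      carry_subset_of ((ih k).trans (e.trueInfo_mono (he.prevTime_le_exchTime n)))
        (e.inl_mem_trueInfo (he.lastArrival_nonneg _ _)
          (e.lastArrival_le _ (he.exchTime_nonneg n)))
    intro i
    simp only [knowledgeAfter]
    refine union_subset (hb i) (iUnion₂_subset fun j _ => union_subset (union_subset (hb j) ?_) ?_)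
    · rw [singleton_subset_iff]
      exact e.inl_mem_trueInfo (he.exchTime_nonneg n) le_rfl
    · rw [singleton_subset_iff]
      intro v k u hu
      cases hu

lemma Regular.knowledge_subset {e : EventSequence N} (he : e.Regular) {t : ℝ} (ht : 0 ≤ t)
    (i : Fin N) : e.knowledge i t ⊆ e.trueInfo t :=
  carry_subset_of
    ((he.knowledgeAfter_subset _ i).trans (e.trueInfo_mono (e.prevTime_exchCount_le ht)))
    (e.inl_mem_trueInfo (he.lastArrival_nonneg _ _) (e.lastArrival_le _ ht))

/-- The age of the most recent information, in terms of its time. -/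
lemma Regular.age_le_iff {e : EventSequence N} (he : e.Regular) {t : ℝ} (ht : 0 ≤ t)
    (j i : Fin N) (s : ℝ) :
    e.age j i t ≤ (s : EReal) ↔
      0 ≤ lastTime t j (e.knowledge i t) ∧ t - lastTime t j (e.knowledge i t) ≤ s := by
  set τ := lastTime t j (e.knowledge i t) with hτ
  have hmem : ∀ u, Sum.inl (e.x j (t - u), j, t - u) ∈ e.knowledge i t ↔
      t - u ∈ infoTimes j (e.knowledge i t) := fun u =>
    ⟨fun h => ⟨_, h⟩, fun ⟨v, h⟩ => by
      rwa [← (he.knowledge_subset ht i h v j _ rfl).1]⟩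
  have hbd : ∀ u ∈ infoTimes j (e.knowledge i t), 0 ≤ u ∧ u ≤ t := fun u hu => by
    obtain ⟨v, h⟩ := hu
    exact (he.knowledge_subset ht i h v j _ rfl).2
  unfold age
  simp only [hmem]
  constructor
  · intro h
    have hne : (infoTimes j (e.knowledge i t)).Nonempty := by
      by_contra hemp
      rw [not_nonempty_iff_eq_empty] at hemp
      simp [hemp] at h
    obtain ⟨u, hu⟩ := hne
    refine ⟨(hbd u hu).1.trans (le_lastTime hu (hbd u hu).2), ?_⟩
    by_contra! hlt
    have h2 : ((t - τ : ℝ) : EReal) ≤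
        sInf {a : EReal | ∃ s : ℝ, a = (s : EReal) ∧ t - s ∈ infoTimes j (e.knowledge i t)} := by
      refine le_sInf ?_
      rintro _ ⟨r, rfl, hr⟩
      have := le_lastTime hr (hbd _ hr).2
      exact EReal.coe_le_coe_iff.2 (by linarith)
    have h3 := EReal.coe_le_coe_iff.1 (h2.trans h)
    linarith
  · rintro ⟨h0, hs⟩
    refine EReal.le_of_forall_lt_iff_le.1 fun b hb => ?_
    have hb' : s < b := EReal.coe_lt_coe_iff.1 hb
    -- The supremum `τ` need not be attained, hence the slack `b > s`. The bound `-1/2` lies between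
    -- the default value `-1` and `0`, so that what exceeds the maximum is a genuine information
    -- time.
    have hlt : ¬ τ ≤ max (t - b) (-(1 / 2)) := by
      rw [not_le, max_lt_iff]; constructor <;> linarith
    rw [hτ, lastTime_le_iff] at hlt
    push Not at hlt
    obtain ⟨u, hu, _, hu2⟩ := hlt (le_max_of_le_right (by norm_num))
    have hmem' : ((t - u : ℝ) : EReal) ∈ {a : EReal | ∃ s : ℝ, a = (s : EReal) ∧
        t - s ∈ infoTimes j (e.knowledge i t)} := ⟨t - u, rfl, by simpa using hu⟩
    refine (sInf_le hmem').trans (EReal.coe_le_coe_iff.2 ?_)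
    linarith [(max_lt_iff.1 hu2).1]

/-! ### Causality -/

/-- `e` and `e'` only differ in what happens to agent `j` after time `s`. -/
structure AgreeUpTo (j : Fin N) (s : ℝ) (e e' : EventSequence N) : Prop where
  exchTime_eq : e'.exchTime = e.exchTime
  exch_eq : e'.exch = e.exch
  lifetime_eq : ∀ k, k ≠ j → e'.lifetime k = e.lifetime k
  value_eq : ∀ k, k ≠ j → e'.value k = e.value k
  x_eq : ∀ u, 0 ≤ u → u ≤ s → e'.x j u = e.x j u
  lastArrival_eq : ∀ u, 0 ≤ u → u ≤ s → e'.lastArrival j u = e.lastArrival j u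

lemma arrival_congr {e e' : EventSequence N} {k : Fin N} (h : e'.lifetime k = e.lifetime k) :
    e'.arrival k = e.arrival k := by
  funext n; simp only [arrival, h]

lemma incarnation_congr {e e' : EventSequence N} {k : Fin N} (h : e'.lifetime k = e.lifetime k) :
    e'.incarnation k = e.incarnation k := by
  funext n; simp only [incarnation, arrival_congr h]

lemma lastArrival_congr {e e' : EventSequence N} {k : Fin N} (h : e'.lifetime k = e.lifetime k) :
    e'.lastArrival k = e.lastArrival k := by
  funext n; simp only [lastArrival, incarnation_congr h, arrival_congr h]

lemma x_congr {e e' : EventSequence N} {k : Fin N} (h : e'.lifetime k = e.lifetime k)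
    (hv : e'.value k = e.value k) : e'.x k = e.x k := by
  funext n; simp only [x, incarnation_congr h, hv]

lemma prevTime_congr {e e' : EventSequence N} (h : e'.exchTime = e.exchTime) :
    e'.prevTime = e.prevTime := by
  funext n; cases n <;> simp [prevTime, h]

lemma exchCount_congr {e e' : EventSequence N} (h : e'.exchTime = e.exchTime) :
    e'.exchCount = e.exchCount := by
  funext n; simp [exchCount, h]

namespace AgreeUpTo

variable {j : Fin N} {s : ℝ} {e e' : EventSequence N}

lemma carry_eq_of_ne (h : AgreeUpTo j s e e') {k : Fin N} (hk : k ≠ j) (u : ℝ)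
    (K : Set (Info N)) (t : ℝ) : e'.carry u K k t = e.carry u K k t := by
  simp only [carry, lastArrival_congr (h.lifetime_eq k hk),
    x_congr (h.lifetime_eq k hk) (h.value_eq k hk)]

lemma carry_eq_self (h : AgreeUpTo j s e e') (he : e.Regular) (u : ℝ)
    (K : Set (Info N)) {t : ℝ} (h0 : 0 ≤ t) (ht : t ≤ s) : e'.carry u K j t = e.carry u K j t := by
  simp only [carry, h.lastArrival_eq t h0 ht, h.x_eq _ (he.lastArrival_nonneg j t)
    ((e.lastArrival_le j h0).trans ht)]

lemma carry_eq (h : AgreeUpTo j s e e') (he : e.Regular) (u : ℝ) (k : Fin N)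
    (K : Set (Info N)) {t : ℝ} (h0 : 0 ≤ t) (ht : t ≤ s) : e'.carry u K k t = e.carry u K k t := by
  by_cases hk : k = j
  · subst hk; exact h.carry_eq_self he u K h0 ht
  · exact h.carry_eq_of_ne hk u K t

lemma x_eq_of_le (h : AgreeUpTo j s e e') (k : Fin N) {t : ℝ} (h0 : 0 ≤ t) (ht : t ≤ s) :
    e'.x k t = e.x k t := by
  by_cases hk : k = j
  · subst hk; exact h.x_eq t h0 ht
  · rw [x_congr (h.lifetime_eq k hk) (h.value_eq k hk)]

/-- Causality: nobody's knowledge depends on the future of `j`. -/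
lemma knowledgeAfter_eq_of_le (h : AgreeUpTo j s e e') (he : e.Regular) (n : ℕ) :
    e.prevTime n ≤ s → ∀ k, e'.knowledgeAfter n k = e.knowledgeAfter n k := by
  induction n with
  | zero =>
    intro h0 k
    simp only [knowledgeAfter, h.x_eq_of_le k le_rfl h0]
  | succ n ih =>
    intro hn k
    have hn' : e.exchTime n ≤ s := hn
    have ih' := ih ((he.prevTime_le_exchTime n).trans hn')
    have h0 := he.exchTime_nonneg n
    simp only [knowledgeAfter, h.exchTime_eq, h.exch_eq, prevTime_congr h.exchTime_eq, ih',
      h.carry_eq he _ _ _ h0 hn', h.x_eq_of_le _ h0 hn']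

/-- The knowledge of the other agents does not depend on what happens to `j` after the time of their
most recent information about `j`. -/
lemma knowledgeAfter_eq (h : AgreeUpTo j s e e') (he : e.Regular) (n : ℕ) :
    ∀ i, i ≠ j → (∀ u ∈ infoTimes j (e.knowledgeAfter n i), u ≤ s) →
      e'.knowledgeAfter n i = e.knowledgeAfter n i := by
  induction n with
  | zero =>
    intro i hi _
    simp only [knowledgeAfter, x_congr (h.lifetime_eq i hi) (h.value_eq i hi)]
  | succ n ih =>
    intro i hi hs
    have h0 := he.exchTime_nonneg n
    have hb : ∀ k, k ≠ j → e.carry (e.prevTime n) (e.knowledgeAfter n k) k (e.exchTime n) ⊆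
        e.knowledgeAfter (n + 1) i →
        e'.carry (e.prevTime n) (e'.knowledgeAfter n k) k (e.exchTime n) =
          e.carry (e.prevTime n) (e.knowledgeAfter n k) k (e.exchTime n) := by
      intro k hk hsub
      rw [h.carry_eq_of_ne hk]
      unfold carry at hsub ⊢
      -- Either `k` has been replaced and its set is reset, or its previous set is passed on whole
      -- to `i`, so that its information times inherit the bound `s`.
      split_ifs with hlt
      · rfl
      · rw [if_neg hlt] at hsub
        exact ih k hk fun u ⟨v, hv⟩ => hs u ⟨v, hsub hv⟩
    simp only [knowledgeAfter, h.exchTime_eq, h.exch_eq, prevTime_congr h.exchTime_eq]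
    congr 1
    · exact hb i hi (by simp only [knowledgeAfter]; exact subset_union_left)
    · refine iUnion₂_congr fun k hk => ?_
      have hsub : e.carry (e.prevTime n) (e.knowledgeAfter n k) k (e.exchTime n) ∪
          {Sum.inl (e.x k (e.exchTime n), k, e.exchTime n)} ∪
          {Sum.inr (k, i, e.exchTime n)} ⊆ e.knowledgeAfter (n + 1) i := by
        simp only [knowledgeAfter]
        refine subset_union_of_subset_right ?_ _
        exact subset_iUnion₂_of_subset k hk subset_rfl
      -- A message from `j` itself records the value of `j` at the exchange time. That time is thus
      -- at most `s`, and the set sent by `j` is covered by agreement up to `s`.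
      by_cases hkj : k = j
      · subst hkj
        have hn : e.exchTime n ≤ s :=
          hs _ ⟨_, hsub (Or.inl (Or.inr (mem_singleton _)))⟩
        rw [h.knowledgeAfter_eq_of_le he n ((he.prevTime_le_exchTime n).trans hn),
          h.carry_eq_self he _ _ h0 hn, h.x_eq _ h0 hn]
      · rw [hb k hkj ((subset_union_left.trans subset_union_left).trans hsub),
          x_congr (h.lifetime_eq k hkj) (h.value_eq k hkj)]

lemma knowledge_eq (h : AgreeUpTo j s e e') (he : e.Regular) {i : Fin N} (hi : i ≠ j) {t : ℝ}
    (hs : ∀ u ∈ infoTimes j (e.knowledge i t), u ≤ s) : e'.knowledge i t = e.knowledge i t := by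
  unfold knowledge at hs ⊢
  rw [h.carry_eq_of_ne hi, exchCount_congr h.exchTime_eq, prevTime_congr h.exchTime_eq]
  unfold carry at hs ⊢
  split_ifs with hlt
  · rfl
  · rw [if_neg hlt] at hs
    exact h.knowledgeAfter_eq he _ i hi hs

lemma knowledge_eq_of_lastTime {i : Fin N} {t : ℝ} (ht : 0 ≤ t) (he : e.Regular) (hi : i ≠ j)
    (h : AgreeUpTo j (lastTime t j (e.knowledge i t)) e e') :
    e'.knowledge i t = e.knowledge i t :=
  h.knowledge_eq he hi fun _ ⟨v, hv⟩ =>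
    le_lastTime ⟨v, hv⟩ (he.knowledge_subset ht i hv v j _ rfl).2.2

end AgreeUpTo

/-! ### Overwriting one lifetime or one value -/

/-- Replace the lifetime of the `n`-th agent with label `j`. -/
def updLifetime (j : Fin N) (n : ℕ) (c : ℝ) (e : EventSequence N) : EventSequence N where
  lifetime := fun i m => if (i, m) = (j, n) then c else e.lifetime i m
  value := e.value
  exchTime := e.exchTime
  exch := e.exch

/-- Replace the value of the `n`-th agent with label `j`. -/
def updValue (j : Fin N) (n : ℕ) (c : ℝ) (e : EventSequence N) : EventSequence N where
  lifetime := e.lifetime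
  value := fun i m => if (i, m) = (j, n) then c else e.value i m
  exchTime := e.exchTime
  exch := e.exch

section Update

variable {e : EventSequence N} {j : Fin N} {n : ℕ} {c : ℝ}

lemma updLifetime_arrival_of_le {m : ℕ} (hm : m ≤ n) :
    (updLifetime j n c e).arrival j m = e.arrival j m := by
  refine Finset.sum_congr rfl fun k hk => ?_
  have : k ≠ n := by have := Finset.mem_range.1 hk; omega
  simp [updLifetime, this]

lemma updLifetime_arrival_succ :
    (updLifetime j n c e).arrival j (n + 1) = e.arrival j n + c := by
  rw [arrival_succ, updLifetime_arrival_of_le le_rfl]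
  simp [updLifetime]

/-- Overwriting one lifetime lowers each arrival time by at most the old lifetime, so the arrivals
still tend to infinity. -/
lemma Regular.updLifetime (he : e.Regular) (hc : 0 < c) : (updLifetime j n c e).Regular where
  lifetime_pos i m := by
    simp only [EventSequence.updLifetime]
    split_ifs
    exacts [hc, he.lifetime_pos i m]
  arrival_tendsto i := by
    have h : ∀ m, e.arrival i m - e.lifetime j n ≤ (EventSequence.updLifetime j n c e).arrival i m := by
      intro m
      have h1 : e.arrival i m ≤ ∑ k ∈ Finset.range m,
          ((EventSequence.updLifetime j n c e).lifetime i k +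
            if k = n then e.lifetime j n else 0) := by
        refine Finset.sum_le_sum fun k _ => ?_
        simp only [EventSequence.updLifetime, Prod.mk.injEq]
        have := he.lifetime_pos j n
        by_cases hk : k = n <;> by_cases hi : i = j
        · subst hk hi; simp [hc.le]
        · simp [hk, hi, this.le]
        · simp [hk]
        · simp [hk]
      rw [Finset.sum_add_distrib, Finset.sum_ite_eq'] at h1
      have h2 : (if n ∈ Finset.range m then e.lifetime j n else 0) ≤ e.lifetime j n := by
        split_ifs
        exacts [le_rfl, (he.lifetime_pos j n).le]
      unfold arrival at *
      linarith
    exact tendsto_atTop_mono h (tendsto_atTop_add_const_right _ _ (he.arrival_tendsto i))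
  exchTime_pos := he.exchTime_pos
  exchTime_strictMono := he.exchTime_strictMono
  exchTime_tendsto := he.exchTime_tendsto

lemma Regular.updValue (he : e.Regular) : (updValue j n c e).Regular where
  lifetime_pos := he.lifetime_pos
  arrival_tendsto := he.arrival_tendsto
  exchTime_pos := he.exchTime_pos
  exchTime_strictMono := he.exchTime_strictMono
  exchTime_tendsto := he.exchTime_tendsto

/-- Arrivals up to number `n` coincide, and both sequences put arrival `n + 1` after `s`. The infima
defining the incarnations are thus reached at indices at most `n`, where the two conditions agree.
-/
lemma updLifetime_incarnation {s u : ℝ} (hs : s < e.arrival j (n + 1))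
    (hs' : s < e.arrival j n + c) (hu : u ≤ s) :
    (updLifetime j n c e).incarnation j u = e.incarnation j u ∧ e.incarnation j u ≤ n := by
  have key : ∀ m ≤ n, u < (updLifetime j n c e).arrival j (m + 1) ↔ u < e.arrival j (m + 1) := by
    intro m hm
    rcases hm.lt_or_eq with hlt | rfl
    · rw [updLifetime_arrival_of_le (by omega)]
    · rw [updLifetime_arrival_succ]
      exact iff_of_true (by linarith) (by linarith)
  have h1 : e.incarnation j u ≤ n := Nat.sInf_le (by simp only [mem_ofPred_eq]; linarith)
  have h2 : (updLifetime j n c e).incarnation j u ≤ n :=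
    Nat.sInf_le (by simp only [mem_ofPred_eq, updLifetime_arrival_succ]; linarith)
  have m1 : u < e.arrival j (e.incarnation j u + 1) :=
    Nat.sInf_mem (s := {n : ℕ | u < e.arrival j (n + 1)})
      ⟨n, by simp only [mem_ofPred_eq]; linarith⟩
  have m2 : u < (updLifetime j n c e).arrival j ((updLifetime j n c e).incarnation j u + 1) :=
    Nat.sInf_mem (s := {m : ℕ | u < (updLifetime j n c e).arrival j (m + 1)})
      ⟨n, by simp only [mem_ofPred_eq, updLifetime_arrival_succ]; linarith⟩
  exact ⟨le_antisymm (Nat.sInf_le ((key _ h1).2 m1)) (Nat.sInf_le ((key _ h2).1 m2)), h1⟩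

lemma agreeUpTo_updLifetime {s : ℝ} (hs : s < e.arrival j (n + 1)) (hs' : s < e.arrival j n + c) :
    AgreeUpTo j s e (updLifetime j n c e) where
  exchTime_eq := rfl
  exch_eq := rfl
  lifetime_eq k hk := by funext m; simp [updLifetime, hk]
  value_eq k hk := rfl
  x_eq u _ hu := by
    unfold x; rw [(updLifetime_incarnation hs hs' hu).1]; rfl
  lastArrival_eq u _ hu := by
    unfold lastArrival
    rw [(updLifetime_incarnation hs hs' hu).1,
      updLifetime_arrival_of_le (updLifetime_incarnation hs hs' hu).2]

lemma AgreeUpTo.symm {s : ℝ} {e' : EventSequence N} (h : AgreeUpTo j s e e') :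
    AgreeUpTo j s e' e where
  exchTime_eq := h.exchTime_eq.symm
  exch_eq := h.exch_eq.symm
  lifetime_eq k hk := (h.lifetime_eq k hk).symm
  value_eq k hk := (h.value_eq k hk).symm
  x_eq u h0 hu := (h.x_eq u h0 hu).symm
  lastArrival_eq u h0 hu := (h.lastArrival_eq u h0 hu).symm

/-- The value of the `n`-th agent is not held by `j` before that agent arrives. -/
lemma agreeUpTo_updValue (he : e.Regular) {s : ℝ} (hs : s < e.arrival j n) :
    AgreeUpTo j s e (updValue j n c e) where
  exchTime_eq := rfl
  exch_eq := rfl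
  lifetime_eq k hk := rfl
  value_eq k hk := by funext m; simp [updValue, hk]
  x_eq u h0 hu := by
    have hlt := (he.incarnation_lt_iff j h0 n).2 (hu.trans_lt hs)
    change (updValue j n c e).value j (e.incarnation j u) = e.value j (e.incarnation j u)
    simp [updValue, hlt.ne]
  lastArrival_eq u _ hu := rfl

end Update

/-! ### Quantities that ignore the values -/

/-- Functions of the replacements and the exchanges only. -/
def ValueFree {α : Type*} (g : EventSequence N → α) : Prop :=
  ∀ e e' : EventSequence N, e'.lifetime = e.lifetime → e'.exchTime = e.exchTime →
    e'.exch = e.exch → g e' = g e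

lemma infoTimes_union (j : Fin N) (K L : Set (Info N)) :
    infoTimes j (K ∪ L) = infoTimes j K ∪ infoTimes j L := by
  ext s; simp [infoTimes, exists_or]

lemma infoTimes_carry (e : EventSequence N) (j : Fin N) (s : ℝ) (K : Set (Info N)) (i : Fin N)
    (t : ℝ) : infoTimes j (e.carry s K i t) =
      if s < e.lastArrival i t then {u | j = i ∧ u = e.lastArrival i t} else infoTimes j K := by
  unfold carry
  split_ifs
  · ext; simp [infoTimes]
  · rfl

/-- Values are copied into the knowledge sets but never decide what is copied or erased. -/
lemma valueFree_infoTimes_knowledgeAfter (j : Fin N) (n : ℕ) :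
    ∀ i, ValueFree fun e : EventSequence N => infoTimes j (e.knowledgeAfter n i) := by
  induction n with
  | zero =>
    intro i e e' _ _ _
    ext; simp [knowledgeAfter, infoTimes]
  | succ n ih =>
    intro i e e' h1 h2 h3
    have hb : ∀ k, infoTimes j (e'.carry (e'.prevTime n) (e'.knowledgeAfter n k) k (e'.exchTime n)) =
        infoTimes j (e.carry (e.prevTime n) (e.knowledgeAfter n k) k (e.exchTime n)) := by
      intro k
      have hk := ih k e e' h1 h2 h3
      simp only at hk
      rw [infoTimes_carry, infoTimes_carry, hk, prevTime_congr h2, h2,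
        lastArrival_congr (congrFun h1 k)]
    have hU : ∀ (f : Fin N → Set (Info N)) (S : Set (Fin N)),
        infoTimes j (⋃ k ∈ S, f k) = ⋃ k ∈ S, infoTimes j (f k) := by
      intro f S
      ext s
      simp only [infoTimes, mem_iUnion, mem_ofPred_eq]
      tauto
    rw [h2] at hb
    simp only [knowledgeAfter, infoTimes_union, hU, h2, h3, hb]
    congr 1
    refine iUnion₂_congr fun k _ => ?_
    congr 2
    ext; simp [infoTimes]

lemma valueFree_lastTime (t : ℝ) (j i : Fin N) :
    ValueFree fun e : EventSequence N => lastTime t j (e.knowledge i t) := by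
  intro e e' h1 h2 h3
  have hk := valueFree_infoTimes_knowledgeAfter j (e.exchCount t) i e e' h1 h2 h3
  simp only at hk
  simp only [lastTime, knowledge, infoTimes_carry, exchCount_congr h2, hk, prevTime_congr h2,
    lastArrival_congr (congrFun h1 i)]

end EventSequence

/-! ### Measurability -/

/-- A measurable selection among countably many measurable functions is measurable. -/
lemma measurable_countable_select {α β : Type*} [MeasurableSpace α] [MeasurableSpace β]
    {k : α → ℕ} (hk : Measurable k) {f : ℕ → α → β} (hf : ∀ n, Measurable (f n)) :
    Measurable fun a => f (k a) a := by
  intro B hB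
  have : (fun a => f (k a) a) ⁻¹' B = ⋃ n, (k ⁻¹' {n} ∩ f n ⁻¹' B) := by
    ext a; simp
  rw [this]
  exact MeasurableSet.iUnion fun n => (hk (measurableSet_singleton n)).inter (hf n hB)

lemma measurable_nat_sInf {α : Type*} [MeasurableSpace α] {p : α → ℕ → Prop}
    (hp : ∀ n, MeasurableSet {a | p a n}) : Measurable fun a => sInf {n | p a n} := by
  refine measurable_to_countable' fun n => ?_
  -- The second piece accounts for `sInf ∅ = 0`: it joins the fiber over `0`.
  have : (fun a => sInf {n | p a n}) ⁻¹' {n} =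
      ({a | p a n} ∩ ⋂ m ∈ Finset.range n, {a | p a m}ᶜ) ∪ ({a | n = 0} ∩ ⋂ m, {a | p a m}ᶜ) := by
    ext a
    simp only [mem_preimage, mem_singleton_iff, mem_union, mem_inter_iff, mem_iInter,
      mem_compl_iff, mem_ofPred_eq, Finset.mem_range]
    constructor
    · rintro rfl
      rcases {n | p a n}.eq_empty_or_nonempty with h | h
      · right
        exact ⟨by rw [h, Nat.sInf_empty], fun m hm => by
          have : m ∈ {n | p a n} := hm
          rw [h] at this; exact this⟩
      · exact Or.inl ⟨Nat.sInf_mem h, fun m hm => Nat.notMem_of_lt_sInf hm⟩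
    · rintro (⟨h, h'⟩ | ⟨rfl, h⟩)
      · refine le_antisymm (Nat.sInf_le h) ?_
        by_contra! hlt
        exact h' _ hlt (Nat.sInf_mem (s := {n | p a n}) ⟨n, h⟩)
      · have : {n | p a n} = ∅ := eq_empty_of_forall_notMem h
        rw [this, Nat.sInf_empty]
  rw [this]
  refine ((hp n).inter (Finset.measurableSet_biInter _ fun m _ => (hp m).compl)).union
    ((MeasurableSet.const _).inter (MeasurableSet.iInter fun m => (hp m).compl))

/-- For `c ≥ -1`, being at most `c` means that the set misses all records about `j` with time in
`(c, t]`, the complement of a generating event; for `c < -1` it is impossible. -/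
lemma measurable_lastTime {N : ℕ} (t : ℝ) (j : Fin N) :
    @Measurable _ _ (knowledgeSigmaAlgebra N) _ (lastTime t j : Set (Info N) → ℝ) := by
  let := knowledgeSigmaAlgebra N
  refine measurable_of_Iic fun c => ?_
  by_cases hc : -1 ≤ c
  · set B : Set (Info N) := Sum.inl '' {p : ℝ × Fin N × ℝ | p.2.1 = j ∧ p.2.2 ≤ t ∧ c < p.2.2}
    have hB : MeasurableSet B := by
      refine MeasurableSet.inl_image ?_
      refine MeasurableSet.inter ?_ (MeasurableSet.inter ?_ ?_)
      · exact measurable_snd.fst (measurableSet_singleton j)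
      · exact measurableSet_le measurable_snd.snd measurable_const
      · exact measurableSet_lt measurable_const measurable_snd.snd
    have : (lastTime t j : Set (Info N) → ℝ) ⁻¹' Iic c = {K | (K ∩ B).Nonempty}ᶜ := by
      ext K
      simp only [mem_preimage, mem_Iic, lastTime_le_iff, hc, true_and, mem_compl_iff,
        mem_ofPred_eq, not_nonempty_iff_eq_empty, eq_empty_iff_forall_notMem]
      constructor
      · rintro h _ ⟨hp, ⟨⟨v, k, s⟩, ⟨rfl, hst, hcs⟩, rfl⟩⟩
        exact absurd (h s ⟨v, hp⟩ hst) (not_le.2 hcs)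
      · rintro h s ⟨v, hv⟩ hst
        by_contra! hcs
        exact h _ ⟨hv, ⟨(v, j, s), ⟨rfl, hst, hcs⟩, rfl⟩⟩
    rw [this]
    exact @MeasurableSet.compl _ _ (knowledgeSigmaAlgebra N)
      (MeasurableSpace.measurableSet_generateFrom ⟨B, hB, rfl⟩)
  · have : (lastTime t j : Set (Info N) → ℝ) ⁻¹' Iic c = ∅ := by
      ext K; simp [lastTime_le_iff, hc]
    rw [this]
    exact @MeasurableSet.empty _ (knowledgeSigmaAlgebra N)

namespace EventSequence

variable {N : ℕ}

/-- With a σ-algebra on whole sequences, independence can be stated between one coordinate and the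
sequence in which it is overwritten. -/
instance : MeasurableSpace (EventSequence N) :=
  MeasurableSpace.comap (fun e => (e.lifetime, e.value, e.exchTime, e.exch)) inferInstance

lemma measurable_toProd :
    Measurable fun e : EventSequence N => (e.lifetime, e.value, e.exchTime, e.exch) :=
  comap_measurable _

lemma measurable_lifetime (i : Fin N) (n : ℕ) :
    Measurable fun e : EventSequence N => e.lifetime i n :=
  (measurable_pi_apply n).comp ((measurable_pi_apply i).comp measurable_toProd.fst)

lemma measurable_value (i : Fin N) (n : ℕ) :
    Measurable fun e : EventSequence N => e.value i n :=
  (measurable_pi_apply n).comp ((measurable_pi_apply i).comp measurable_toProd.snd.fst)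

lemma measurable_exchTime (n : ℕ) : Measurable fun e : EventSequence N => e.exchTime n :=
  (measurable_pi_apply n).comp measurable_toProd.snd.snd.fst

lemma measurableSet_exch (n : ℕ) (p : Fin N × Fin N) :
    MeasurableSet {e : EventSequence N | p ∈ e.exch n} :=
  measurableSet_setOfPred.2 <| (measurable_set_mem p).comp
    ((measurable_pi_apply n).comp measurable_toProd.snd.snd.snd)

lemma measurable_of_coordinates {α : Type*} [MeasurableSpace α] {g : α → EventSequence N}
    (h1 : ∀ i n, Measurable fun a => (g a).lifetime i n)
    (h2 : ∀ i n, Measurable fun a => (g a).value i n)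
    (h3 : ∀ n, Measurable fun a => (g a).exchTime n)
    (h4 : ∀ n p, MeasurableSet {a | p ∈ (g a).exch n}) : Measurable g := by
  refine measurable_comap_iff.2 ?_
  refine Measurable.prodMk (measurable_pi_lambda _ fun i => measurable_pi_lambda _ (h1 i))
    (Measurable.prodMk (measurable_pi_lambda _ fun i => measurable_pi_lambda _ (h2 i))
    (Measurable.prodMk (measurable_pi_lambda _ h3) (measurable_pi_lambda _ fun n => ?_)))
  exact measurable_set_iff.2 fun p => measurableSet_setOfPred.1 (h4 n p)

lemma measurable_updLifetime (j : Fin N) (n : ℕ) (c : ℝ) : Measurable (updLifetime j n c) := by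
  refine measurable_of_coordinates (fun i m => ?_) measurable_value measurable_exchTime
    measurableSet_exch
  simp only [updLifetime]
  split_ifs
  exacts [measurable_const, measurable_lifetime i m]

lemma measurable_updValue (j : Fin N) (n : ℕ) (c : ℝ) : Measurable (updValue j n c) := by
  refine measurable_of_coordinates measurable_lifetime (fun i m => ?_) measurable_exchTime
    measurableSet_exch
  simp only [updValue]
  split_ifs
  exacts [measurable_const, measurable_value i m]

lemma measurable_arrival (i : Fin N) (n : ℕ) : Measurable fun e : EventSequence N => e.arrival i n :=
  Finset.measurable_fun_sum _ fun k _ => measurable_lifetime i k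

variable {θ : EventSequence N → ℝ}

lemma measurable_incarnation (i : Fin N) (hθ : Measurable θ) :
    Measurable fun e : EventSequence N => e.incarnation i (θ e) :=
  measurable_nat_sInf fun n => measurableSet_lt hθ (measurable_arrival i (n + 1))

lemma measurable_x (i : Fin N) (hθ : Measurable θ) :
    Measurable fun e : EventSequence N => e.x i (θ e) :=
  measurable_countable_select (measurable_incarnation i hθ) fun n => measurable_value i n

lemma measurable_lastArrival (i : Fin N) (hθ : Measurable θ) :
    Measurable fun e : EventSequence N => e.lastArrival i (θ e) :=
  measurable_countable_select (measurable_incarnation i hθ) fun n => measurable_arrival i n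

lemma measurable_prevTime (n : ℕ) : Measurable fun e : EventSequence N => e.prevTime n := by
  cases n with
  | zero => exact measurable_const
  | succ n => exact measurable_exchTime n

lemma measurable_exchCount (t : ℝ) : Measurable fun e : EventSequence N => e.exchCount t :=
  measurable_nat_sInf fun n => measurableSet_lt measurable_const (measurable_exchTime n)

lemma measurable_average (t : ℝ) : Measurable fun e : EventSequence N => e.average t :=
  (Finset.measurable_fun_sum _ fun i _ => measurable_x i measurable_const).const_mul _

/-- Measurability of random sets of pieces of information, in terms of hitting events. -/
def HitMeasurable (K : EventSequence N → Set (Info N)) : Prop :=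
  ∀ B : Set (Info N), MeasurableSet B → MeasurableSet {e | (K e ∩ B).Nonempty}

lemma HitMeasurable.measurable {K : EventSequence N → Set (Info N)} (hK : HitMeasurable K) :
    @Measurable _ _ _ (knowledgeSigmaAlgebra N) K := by
  refine measurable_generateFrom ?_
  rintro _ ⟨B, hB, rfl⟩
  exact hK B hB

lemma hitMeasurable_singleton {f : EventSequence N → Info N} (hf : Measurable f) :
    HitMeasurable fun e => {f e} := by
  intro B hB
  simp only [singleton_inter_nonempty]
  exact hf hB

lemma HitMeasurable.union {K L : EventSequence N → Set (Info N)} (hK : HitMeasurable K)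
    (hL : HitMeasurable L) : HitMeasurable fun e => K e ∪ L e := by
  intro B hB
  simp only [union_inter_distrib_right, union_nonempty]
  exact (hK B hB).union (hL B hB)

lemma HitMeasurable.iUnion {ι : Type*} [Countable ι] {K : ι → EventSequence N → Set (Info N)}
    (hK : ∀ k, HitMeasurable (K k)) : HitMeasurable fun e => ⋃ k, K k e := by
  intro B hB
  simp only [iUnion_inter, nonempty_iUnion]
  rw [ofPred_exists]
  exact MeasurableSet.iUnion fun k => hK k B hB

lemma HitMeasurable.iUnion_prop {p : EventSequence N → Prop} (hp : MeasurableSet {e | p e})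
    {K : EventSequence N → Set (Info N)} (hK : HitMeasurable K) :
    HitMeasurable fun e => ⋃ _ : p e, K e := by
  intro B hB
  have : {e | ((⋃ _ : p e, K e) ∩ B).Nonempty} = {e | p e} ∩ {e | (K e ∩ B).Nonempty} := by
    ext e
    by_cases h : p e <;> simp [h]
  rw [this]
  exact hp.inter (hK B hB)

lemma HitMeasurable.ite {p : EventSequence N → Prop} (hp : MeasurableSet {e | p e})
    [DecidablePred p] {K L : EventSequence N → Set (Info N)} (hK : HitMeasurable K)
    (hL : HitMeasurable L) : HitMeasurable fun e => if p e then K e else L e := by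
  intro B hB
  have : {e | ((if p e then K e else L e) ∩ B).Nonempty} =
      ({e | p e} ∩ {e | (K e ∩ B).Nonempty}) ∪ ({e | p e}ᶜ ∩ {e | (L e ∩ B).Nonempty}) := by
    ext e
    by_cases h : p e <;> simp [h]
  rw [this]
  exact (hp.inter (hK B hB)).union (hp.compl.inter (hL B hB))

lemma HitMeasurable.carry {K : EventSequence N → Set (Info N)} (hK : HitMeasurable K) (i : Fin N)
    {s : EventSequence N → ℝ} (hs : Measurable s) (hθ : Measurable θ) :
    HitMeasurable fun e => e.carry (s e) (K e) i (θ e) := by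
  have h := measurable_lastArrival i hθ
  refine HitMeasurable.ite (measurableSet_lt hs h) (hitMeasurable_singleton ?_) hK
  exact measurable_inl.comp ((measurable_x i h).prodMk (measurable_const.prodMk h))

/-- Hitting a set commutes with unions, so only singletons, case distinctions and countable unions
have to be handled. -/
lemma hitMeasurable_knowledgeAfter (n : ℕ) :
    ∀ i, HitMeasurable fun e : EventSequence N => e.knowledgeAfter n i := by
  induction n with
  | zero =>
    intro i
    exact hitMeasurable_singleton
      (measurable_inl.comp ((measurable_x i measurable_const).prodMk measurable_const))
  | succ n ih =>
    intro i
    have hb := fun k => (ih k).carry k (measurable_prevTime n) (measurable_exchTime n)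
    simp only [knowledgeAfter]
    refine (hb i).union (HitMeasurable.iUnion fun k => HitMeasurable.iUnion_prop
      (measurableSet_exch n (k, i)) (((hb k).union ?_).union ?_))
    · exact hitMeasurable_singleton (measurable_inl.comp
        ((measurable_x k (measurable_exchTime n)).prodMk
          (measurable_const.prodMk (measurable_exchTime n))))
    · exact hitMeasurable_singleton (measurable_inr.comp
        (measurable_const.prodMk (measurable_const.prodMk (measurable_exchTime n))))

lemma measurable_knowledge (i : Fin N) (t : ℝ) :
    @Measurable _ _ _ (knowledgeSigmaAlgebra N) fun e : EventSequence N => e.knowledge i t :=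
  @measurable_countable_select _ _ _ (knowledgeSigmaAlgebra N) _ (measurable_exchCount t)
    (fun n e => e.carry (e.prevTime n) (e.knowledgeAfter n i) i t) fun n =>
      ((hitMeasurable_knowledgeAfter n i).carry i (measurable_prevTime n) measurable_const).measurable

lemma measurable_lastTime_knowledge (t : ℝ) (j i : Fin N) :
    Measurable fun e : EventSequence N => lastTime t j (e.knowledge i t) :=
  @Measurable.comp _ _ _ _ (knowledgeSigmaAlgebra N) _ _ _ (measurable_lastTime t j)
    (measurable_knowledge i t)

end EventSequence

/-! ### Independence tools -/

section Independence

variable {Ω : Type*} [MeasurableSpace Ω] {μ : Measure Ω}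

/-- The joint law factors as `(X ⊗ Y) ⊗ Z`; reassociating gives `X ⊗ (Y ⊗ Z)`. -/
lemma IndepFun.prodMk_right_of_prodMk_left [IsProbabilityMeasure μ] {α β γ : Type*} [MeasurableSpace α] [MeasurableSpace β]
    [MeasurableSpace γ] {X : Ω → α} {Y : Ω → β} {Z : Ω → γ}
    (hX : Measurable X) (hY : Measurable Y) (hZ : Measurable Z)
    (h1 : IndepFun X Y μ) (h2 : IndepFun (fun ω => (X ω, Y ω)) Z μ) :
    IndepFun X (fun ω => (Y ω, Z ω)) μ := by
  have : IsProbabilityMeasure (μ.map X) := Measure.isProbabilityMeasure_map hX.aemeasurable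
  have : IsProbabilityMeasure (μ.map Y) := Measure.isProbabilityMeasure_map hY.aemeasurable
  have : IsProbabilityMeasure (μ.map Z) := Measure.isProbabilityMeasure_map hZ.aemeasurable
  have h3 : IndepFun Y Z μ := h2.comp measurable_snd measurable_id
  rw [indepFun_iff_map_prod_eq_prod_map_map hX.aemeasurable (hY.prodMk hZ).aemeasurable,
    (indepFun_iff_map_prod_eq_prod_map_map hY.aemeasurable hZ.aemeasurable).1 h3,
    ← Measure.prodAssoc_prod,
    ← (indepFun_iff_map_prod_eq_prod_map_map hX.aemeasurable hY.aemeasurable).1 h1,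
    ← (indepFun_iff_map_prod_eq_prod_map_map (hX.prodMk hY).aemeasurable hZ.aemeasurable).1 h2,
    Measure.map_map MeasurableEquiv.prodAssoc.measurable ((hX.prodMk hY).prodMk hZ)]
  rfl

/-- In an independent family, one member is independent of all others together. -/
lemma iIndepFun.indepFun_ite {ι : Type*} [DecidableEq ι] {X : ι → Ω → ℝ} (hX : ∀ i, Measurable (X i))
    (h : iIndepFun X μ) (p : ι) (c : ℝ) :
    IndepFun (X p) (fun ω q => if q = p then c else X q ω) μ := by
  have h' := indep_iSup_of_disjoint (fun i => (hX i).comap_le) h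
    (S := {p}) (T := {p}ᶜ) disjoint_compl_right
  rw [IndepFun_iff_Indep]
  refine indep_of_indep_of_le_left (indep_of_indep_of_le_right h' ?_) ?_
  · rw [← measurable_iff_comap_le]
    refine @measurable_pi_lambda _ _ _ (_) _ _ fun q => ?_
    by_cases hq : q = p
    · simp only [hq, if_true]; exact measurable_const
    · simp only [hq, if_false]
      refine Measurable.of_comap_le ?_
      exact le_iSup₂_of_le (f := fun i (_ : i ∈ ({p}ᶜ : Set ι)) =>
        MeasurableSpace.comap (X i) inferInstance) q hq le_rfl
  · exact le_iSup₂_of_le (f := fun i (_ : i ∈ ({p} : Set ι)) =>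
        MeasurableSpace.comap (X i) inferInstance) p rfl le_rfl

/-- Fubini on the product law. This stands in for conditioning on `W`. -/
lemma integral_eq_zero_of_indepFun [IsProbabilityMeasure μ] {β : Type*} [MeasurableSpace β] {X : Ω → ℝ} {W : Ω → β}
    (hX : Measurable X) (hW : Measurable W) (h : IndepFun X W μ) {φ : ℝ × β → ℝ}
    (hφ : Measurable φ) (hint : Integrable (fun ω => φ (X ω, W ω)) μ)
    (h0 : ∀ᵐ ω ∂μ, ∫ x, φ (x, W ω) ∂(μ.map X) = 0) : ∫ ω, φ (X ω, W ω) ∂μ = 0 := by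
  have : IsProbabilityMeasure (μ.map X) := Measure.isProbabilityMeasure_map hX.aemeasurable
  have : IsProbabilityMeasure (μ.map W) := Measure.isProbabilityMeasure_map hW.aemeasurable
  have hmap := (indepFun_iff_map_prod_eq_prod_map_map hX.aemeasurable hW.aemeasurable).1 h
  have hXW := (hX.prodMk hW).aemeasurable (μ := μ)
  have hint' : Integrable φ ((μ.map X).prod (μ.map W)) := by
    rw [← hmap, integrable_map_measure hφ.aestronglyMeasurable hXW]
    exact hint
  have e1 : ∫ ω, φ (X ω, W ω) ∂μ = ∫ z, φ z ∂((μ.map X).prod (μ.map W)) := by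
    rw [← hmap, integral_map hXW hφ.aestronglyMeasurable]
  rw [e1, integral_prod_symm _ hint', integral_map hW.aemeasurable
    hint'.integral_prod_right.aestronglyMeasurable]
  exact integral_eq_zero_of_ae h0

end Independence

lemma expMeasure_real_Ioi {lam : ℝ} (hlam : 0 < lam) {a : ℝ} (ha : 0 ≤ a) :
    (expMeasure lam).real (Ioi a) = Real.exp (-(lam * a)) := by
  have := isProbabilityMeasure_expMeasure hlam
  rw [← compl_Iic, probReal_compl_eq_one_sub measurableSet_Iic, ← cdf_eq_real,
    cdf_expMeasure_eq hlam, if_pos ha]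
  ring

/-- An integrable function whose integrals on the fibers of a countable partition vanish. -/
lemma integral_eq_zero_of_fibers {Ω : Type*} [MeasurableSpace Ω] {μ : Measure Ω} {k : Ω → ℕ}
    (hk : Measurable k) {f : Ω → ℝ} (hf : Integrable f μ)
    (h0 : ∀ n, ∫ ω, (k ⁻¹' {n}).indicator f ω ∂μ = 0) : ∫ ω, f ω ∂μ = 0 := by
  have hm : ∀ n, MeasurableSet (k ⁻¹' {n}) := fun n => hk (measurableSet_singleton n)
  have hU : ⋃ n, k ⁻¹' {n} = univ := by ext; simp
  rw [← setIntegral_univ, ← hU, integral_iUnion hm ?_ hf.integrableOn]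
  · simp only [← integral_indicator (hm _), h0, tsum_zero]
  · intro m n hmn
    exact Disjoint.preimage _ (by simpa using hmn)

/-! ### Almost sure regularity, isolation of one coordinate, second moments -/

namespace IsOpenSystem

open EventSequence

variable {Ω : Type*} [MeasurableSpace Ω] {μ : Measure Ω} {N : ℕ}
  {e : Ω → EventSequence N} {lam sig : ℝ}

lemma measurable (he : IsOpenSystem μ e lam sig) : Measurable e :=
  measurable_of_coordinates he.measurable_lifetime he.measurable_value he.measurable_exchTime
    he.measurable_exch

lemma measure_lifetime_le (he : IsOpenSystem μ e lam sig) (hlam : 0 < lam) (i : Fin N) (n : ℕ)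
    {a : ℝ} (ha : 0 ≤ a) :
    μ {ω | (e ω).lifetime i n ≤ a} = ENNReal.ofReal (1 - Real.exp (-(lam * a))) := by
  have := isProbabilityMeasure_expMeasure hlam
  have h : μ {ω | (e ω).lifetime i n ≤ a} = expMeasure lam (Iic a) := by
    rw [← he.lifetime_law i n, Measure.map_apply (he.measurable_lifetime i n) measurableSet_Iic]
    rfl
  rw [h, ← ofReal_measureReal, ← cdf_eq_real, cdf_expMeasure_eq hlam, if_pos ha]

lemma ae_lifetime_pos (he : IsOpenSystem μ e lam sig) (hlam : 0 < lam) (i : Fin N) (n : ℕ) :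
    ∀ᵐ ω ∂μ, 0 < (e ω).lifetime i n := by
  rw [ae_iff]
  simp only [not_lt]
  rw [he.measure_lifetime_le hlam i n le_rfl]
  simp

/-- The first `n` lifetimes are all at most `a` with probability `q ^ n`, where `q < 1`. -/
lemma ae_exists_lifetime_gt (he : IsOpenSystem μ e lam sig) (hlam : 0 < lam) (i : Fin N) {a : ℝ}
    (ha : 0 ≤ a) : ∀ᵐ ω ∂μ, ∃ n, a < (e ω).lifetime i n := by
  rw [ae_iff]
  push Not
  set q := ENNReal.ofReal (1 - Real.exp (-(lam * a))) with hq
  have hq1 : q < 1 := by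
    rw [hq, ← ENNReal.ofReal_one, ENNReal.ofReal_lt_ofReal_iff one_pos]
    linarith [Real.exp_pos (-(lam * a))]
  have hind : iIndepFun (fun (k : ℕ) ω => (e ω).lifetime i k) μ :=
    he.lifetime_indep.precomp (g := fun k : ℕ => (i, k)) fun _ _ h => by simpa using h
  have hle : ∀ n, μ {ω | ∀ k, (e ω).lifetime i k ≤ a} ≤ q ^ n := by
    intro n
    calc μ {ω | ∀ k, (e ω).lifetime i k ≤ a}
        ≤ μ (⋂ k ∈ Finset.range n, (fun ω => (e ω).lifetime i k) ⁻¹' Iic a) :=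
          measure_mono fun ω hω => by simpa using fun k _ => hω k
      _ = ∏ k ∈ Finset.range n, μ ((fun ω => (e ω).lifetime i k) ⁻¹' Iic a) :=
          hind.measure_inter_preimage_eq_mul _ fun _ _ => measurableSet_Iic
      _ = q ^ n := by
          simp only [preimage, mem_Iic, he.measure_lifetime_le hlam i _ ha, Finset.prod_const,
            Finset.card_range, hq]
  exact le_antisymm (ge_of_tendsto' (ENNReal.tendsto_pow_atTop_nhds_zero_of_lt_one hq1) hle)
    (zero_le)

/-- Arrivals diverge because, almost surely, each integer bound is exceeded by some single lifetime.
-/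
lemma ae_regular (he : IsOpenSystem μ e lam sig) (hlam : 0 < lam) :
    ∀ᵐ ω ∂μ, (e ω).Regular := by
  have h1 : ∀ᵐ ω ∂μ, ∀ i n, 0 < (e ω).lifetime i n :=
    ae_all_iff.2 fun i => ae_all_iff.2 fun n => he.ae_lifetime_pos hlam i n
  have h2 : ∀ᵐ ω ∂μ, ∀ i, ∀ M : ℕ, ∃ n, (M : ℝ) < (e ω).lifetime i n :=
    ae_all_iff.2 fun i => ae_all_iff.2 fun M => he.ae_exists_lifetime_gt hlam i M.cast_nonneg
  filter_upwards [h1, h2, he.exchTime_pos, he.exchTime_strictMono, he.exchTime_tendsto]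
    with ω h1 h2 h3 h4 h5
  refine ⟨h1, fun i => ?_, h3, h4, h5⟩
  have hmono : Monotone ((e ω).arrival i) := monotone_nat_of_le_succ fun n => by
    rw [arrival_succ]; linarith [h1 i n]
  refine tendsto_atTop_atTop_of_monotone hmono fun b => ?_
  obtain ⟨M, hM⟩ := exists_nat_ge b
  obtain ⟨n, hn⟩ := h2 i M
  refine ⟨n + 1, ?_⟩
  have h0 : 0 ≤ (e ω).arrival i n := by simpa using hmono (Nat.zero_le n)
  rw [arrival_succ]
  linarith

lemma lintegral_value_sq (he : IsOpenSystem μ e lam sig) (j : Fin N) (n : ℕ) :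
    ∫⁻ ω, ENNReal.ofReal ((e ω).value j n ^ 2) ∂μ = ENNReal.ofReal (sig ^ 2) := by
  rw [← he.value_variance j n, ofReal_integral_eq_lintegral_ofReal (he.value_memLp j n).integrable_sq
    (ae_of_all _ fun _ => sq_nonneg _)]

variable [IsProbabilityMeasure μ]

/-- A lifetime is independent of everything else. -/
lemma indepFun_updLifetime (he : IsOpenSystem μ e lam sig) (j : Fin N) (n : ℕ) (c : ℝ) :
    IndepFun (fun ω => (e ω).lifetime j n) (fun ω => updLifetime j n c (e ω)) μ := by
  have hm : Measurable fun ω => (e ω).lifetime :=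
    measurable_pi_lambda _ fun i => measurable_pi_lambda _ (he.measurable_lifetime i)
  have hZ : Measurable fun ω => (((e ω).exchTime, (e ω).exch), (e ω).value) :=
    (measurable_toProd.snd.snd.prodMk measurable_toProd.snd.fst).comp he.measurable
  have h1 := iIndepFun.indepFun_ite (fun p : Fin N × ℕ => he.measurable_lifetime p.1 p.2)
    he.lifetime_indep (j, n) c
  have hφ : Measurable fun l : Fin N → ℕ → ℝ =>
      (l j n, fun q : Fin N × ℕ => if q = (j, n) then c else l q.1 q.2) := by
    refine Measurable.prodMk (by fun_prop) (measurable_pi_lambda _ fun q => ?_)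
    split_ifs <;> fun_prop
  have h3 := IndepFun.prodMk_right_of_prodMk_left (he.measurable_lifetime j n)
    ((hφ.snd).comp hm) hZ h1 (he.indep_replacements.comp hφ measurable_id)
  refine h3.comp measurable_id (ψ := fun z : (Fin N × ℕ → ℝ) × _ => EventSequence.mk
    (fun i m => z.1 (i, m)) z.2.2 z.2.1.1 z.2.1.2) ?_
  refine measurable_of_coordinates (fun i m => by fun_prop) (fun i m => by fun_prop)
    (fun m => by fun_prop) (fun m p => ?_)
  exact measurableSet_setOfPred.2 <| (measurable_set_mem p).comp
    ((measurable_pi_apply m).comp measurable_snd.fst.snd)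

/-- A value is independent of everything else. -/
lemma indepFun_updValue (he : IsOpenSystem μ e lam sig) (j : Fin N) (n : ℕ) (c : ℝ) :
    IndepFun (fun ω => (e ω).value j n) (fun ω => updValue j n c (e ω)) μ := by
  have hm : Measurable fun ω => (e ω).value :=
    measurable_pi_lambda _ fun i => measurable_pi_lambda _ (he.measurable_value i)
  have hl : Measurable fun ω => (e ω).lifetime :=
    measurable_pi_lambda _ fun i => measurable_pi_lambda _ (he.measurable_lifetime i)
  have hE : Measurable fun ω => ((e ω).exchTime, (e ω).exch) :=
    measurable_toProd.snd.snd.comp he.measurable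
  have h0 : IndepFun (fun ω => (e ω).value)
      (fun ω => (((e ω).exchTime, (e ω).exch), (e ω).lifetime)) μ :=
    IndepFun.prodMk_right_of_prodMk_left hm hE hl he.indep_exchanges.symm
      (he.indep_replacements.symm.comp measurable_swap measurable_id)
  have h1 := iIndepFun.indepFun_ite (fun p : Fin N × ℕ => he.measurable_value p.1 p.2)
    he.value_indep (j, n) c
  have hφ : Measurable fun l : Fin N → ℕ → ℝ =>
      (l j n, fun q : Fin N × ℕ => if q = (j, n) then c else l q.1 q.2) := by
    refine Measurable.prodMk (by fun_prop) (measurable_pi_lambda _ fun q => ?_)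
    split_ifs <;> fun_prop
  have h3 := IndepFun.prodMk_right_of_prodMk_left (he.measurable_value j n)
    ((hφ.snd).comp hm) (hE.prodMk hl) h1 (h0.comp hφ measurable_id)
  refine h3.comp measurable_id (ψ := fun z : (Fin N × ℕ → ℝ) × _ => EventSequence.mk
    z.2.2 (fun i m => z.1 (i, m)) z.2.1.1 z.2.1.2) ?_
  refine measurable_of_coordinates (fun i m => by fun_prop) (fun i m => by fun_prop)
    (fun m => by fun_prop) (fun m p => ?_)
  exact measurableSet_setOfPred.2 <| (measurable_set_mem p).comp
    ((measurable_pi_apply m).comp measurable_snd.fst.snd)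

/-- The value held at a time chosen without looking at the values has second moment `sig ^ 2`,
conditionally on the replacements and exchanges. -/
lemma lintegral_x_sq_mul (he : IsOpenSystem μ e lam sig) (j : Fin N) {θ : EventSequence N → ℝ}
    (hθ : Measurable θ) (hθv : ValueFree θ) {g : EventSequence N → ENNReal} (hg : Measurable g)
    (hgv : ValueFree g) :
    ∫⁻ ω, ENNReal.ofReal ((e ω).x j (θ (e ω)) ^ 2) * g (e ω) ∂μ =
      ENNReal.ofReal (sig ^ 2) * ∫⁻ ω, g (e ω) ∂μ := by
  -- Split according to which agent holds the label at time `θ`; this index ignores the values.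
  set k : EventSequence N → ℕ := fun e => e.incarnation j (θ e) with hk
  have hkm : Measurable k := measurable_incarnation j hθ
  have hkv : ValueFree k := fun e e' h1 h2 h3 => by
    simp only [hk, hθv e e' h1 h2 h3, incarnation_congr (congrFun h1 j)]
  set G : ℕ → EventSequence N → ENNReal := fun n => (k ⁻¹' {n}).indicator g with hG
  have hGm : ∀ n, Measurable (G n) := fun n => hg.indicator (hkm (measurableSet_singleton n))
  -- Since `G n` ignores the values, it is a function of the overwritten sequence, hence independent
  -- of the `n`-th value.
  have hGu : ∀ n e, G n (updValue j n 0 e) = G n e := fun n e => by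
    simp only [hG, indicator, mem_preimage, mem_singleton_iff,
      hkv e (updValue j n 0 e) rfl rfl rfl, hgv e (updValue j n 0 e) rfl rfl rfl]
  have hsum : ∀ e, ∑' n, G n e = g e := fun e => by
    rw [tsum_eq_single (k e)]
    · simp [hG]
    · intro n hn; simp [hG, hn.symm]
  have h1 : ∀ ω, ENNReal.ofReal ((e ω).x j (θ (e ω)) ^ 2) * g (e ω) =
      ∑' n, ENNReal.ofReal ((e ω).value j n ^ 2) * G n (e ω) := fun ω => by
    rw [tsum_eq_single (k (e ω))]
    · simp [hG, hk, x]
    · intro n hn; simp [hG, hn.symm]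
  have hv : ∀ n, Measurable fun ω => ENNReal.ofReal ((e ω).value j n ^ 2) := fun n =>
    ((he.measurable_value j n).pow_const 2).ennreal_ofReal
  have hGe : ∀ n, Measurable fun ω => G n (e ω) := fun n => (hGm n).comp he.measurable
  simp only [h1]
  rw [lintegral_tsum (f := fun n ω => ENNReal.ofReal ((e ω).value j n ^ 2) * G n (e ω))
    fun n => ((hv n).mul (hGe n)).aemeasurable]
  have h2 : ∀ n, ∫⁻ ω, ENNReal.ofReal ((e ω).value j n ^ 2) * G n (e ω) ∂μ =
      ENNReal.ofReal (sig ^ 2) * ∫⁻ ω, G n (e ω) ∂μ := fun n => by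
    rw [← he.lintegral_value_sq j n]
    have hind : IndepFun (fun ω => ENNReal.ofReal ((e ω).value j n ^ 2))
        (fun ω => G n (e ω)) μ := by
      have := (he.indepFun_updValue j n 0).comp
        (φ := fun v : ℝ => ENNReal.ofReal (v ^ 2)) (by fun_prop) (hGm n)
      simpa only [Function.comp_def, hGu] using this
    exact lintegral_mul_eq_lintegral_mul_lintegral_of_indepFun (hv n)
      ((hGm n).comp he.measurable) hind
  simp only [h2, ENNReal.tsum_mul_left]
  rw [← lintegral_tsum fun n => (hGe n).aemeasurable]
  simp only [hsum]

lemma memLp_x (he : IsOpenSystem μ e lam sig) (j : Fin N) {θ : EventSequence N → ℝ}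
    (hθ : Measurable θ) (hθv : ValueFree θ) : MemLp (fun ω => (e ω).x j (θ (e ω))) 2 μ := by
  have hm := (measurable_x j hθ).comp he.measurable
  refine (memLp_two_iff_integrable_sq hm.aestronglyMeasurable).2
    ⟨(hm.pow_const 2).aestronglyMeasurable, ?_⟩
  rw [hasFiniteIntegral_iff_ofReal (ae_of_all _ fun _ => sq_nonneg _)]
  have := he.lintegral_x_sq_mul j hθ hθv (g := fun _ => 1) measurable_const (fun _ _ _ _ _ => rfl)
  simp only [mul_one, lintegral_one, measure_univ] at this
  simp only [Function.comp_apply]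
  rw [this]
  exact ENNReal.ofReal_lt_top

lemma integral_x_sq_mul (he : IsOpenSystem μ e lam sig) (j : Fin N) {θ : EventSequence N → ℝ}
    (hθ : Measurable θ) (hθv : ValueFree θ) {g : EventSequence N → ℝ} (hg : Measurable g)
    (hgv : ValueFree g) (hg0 : ∀ e, 0 ≤ g e) :
    ∫ ω, (e ω).x j (θ (e ω)) ^ 2 * g (e ω) ∂μ = sig ^ 2 * ∫ ω, g (e ω) ∂μ := by
  have hm : Measurable fun ω => (e ω).x j (θ (e ω)) := (measurable_x j hθ).comp he.measurable
  have hge : Measurable fun ω => g (e ω) := hg.comp he.measurable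
  rw [integral_eq_lintegral_of_nonneg_ae (ae_of_all _ fun ω => mul_nonneg (sq_nonneg _) (hg0 _))
      ((hm.pow_const 2).mul hge).aestronglyMeasurable,
    integral_eq_lintegral_of_nonneg_ae (ae_of_all _ fun ω => hg0 _) hge.aestronglyMeasurable]
  simp only [ENNReal.ofReal_mul (sq_nonneg _)]
  rw [he.lintegral_x_sq_mul j hθ hθv hg.ennreal_ofReal
    (fun e e' h1 h2 h3 => by simp only [hgv e e' h1 h2 h3]), ENNReal.toReal_mul,
    ENNReal.toReal_ofReal (sq_nonneg _)]

end IsOpenSystem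

/-! ### The best prediction -/

namespace EventSequence

variable {N : ℕ} {i j k : Fin N} {t lam : ℝ} {e e' : EventSequence N}

/-- The time of the most recent information about `j` available to `i` at time `t`. -/
noncomputable abbrev latest (t : ℝ) (j i : Fin N) (e : EventSequence N) : ℝ :=
  lastTime t j (e.knowledge i t)

/-- The probability that an agent is not replaced between times `latest t j i e` and `t`. -/
noncomputable def weight (lam t : ℝ) (j i : Fin N) (e : EventSequence N) : ℝ :=
  if 0 ≤ latest t j i e then Real.exp (-(lam * (t - latest t j i e))) else 0

/-- The best prediction by `i` of the value of `j` at time `t`. -/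
noncomputable def prediction (lam t : ℝ) (j i : Fin N) (e : EventSequence N) : ℝ :=
  weight lam t j i e * e.x j (latest t j i e)

/-- The error of the best prediction by `i` of the value of `j` at time `t`. -/
noncomputable def predictionError (lam t : ℝ) (j i : Fin N) (e : EventSequence N) : ℝ :=
  e.x j t - prediction lam t j i e

/-- `Y` does not depend on what happens to `j` after the time of the most recent information
about `j` available to `i` at time `t`. -/
def Insensitive {α : Type*} (t : ℝ) (j i : Fin N) (Y : EventSequence N → α) : Prop :=
  ∀ e e' : EventSequence N, e.Regular → e'.Regular →
    AgreeUpTo j (latest t j i e) e e' → Y e' = Y e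

lemma measurable_weight (lam t : ℝ) (j i : Fin N) :
    Measurable (weight lam t j i) := by
  have := measurable_lastTime_knowledge t j i
  refine Measurable.ite (measurableSet_le measurable_const this) ?_ measurable_const
  fun_prop

lemma measurable_prediction (lam t : ℝ) (j i : Fin N) :
    Measurable (prediction lam t j i) :=
  (measurable_weight lam t j i).mul (measurable_x j (measurable_lastTime_knowledge t j i))

lemma measurable_predictionError (lam t : ℝ) (j i : Fin N) :
    Measurable (predictionError lam t j i) :=
  (measurable_x j measurable_const).sub (measurable_prediction lam t j i)

lemma valueFree_weight (lam t : ℝ) (j i : Fin N) : ValueFree (weight lam t j i) := by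
  intro e e' h1 h2 h3
  have := valueFree_lastTime t j i e e' h1 h2 h3
  simp only at this
  simp only [weight, latest, this]

lemma weight_nonneg (lam t : ℝ) (j i : Fin N) (e : EventSequence N) : 0 ≤ weight lam t j i e := by
  unfold weight
  split_ifs
  exacts [(Real.exp_pos _).le, le_rfl]

lemma weight_le_one (hlam : 0 < lam) (ht : 0 ≤ t) (j i : Fin N) (e : EventSequence N) :
    weight lam t j i e ≤ 1 := by
  unfold weight
  split_ifs
  · rw [Real.exp_le_one_iff]
    have : latest t j i e ≤ t := lastTime_le ht
    have := mul_nonneg hlam.le (sub_nonneg.2 this)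
    linarith
  · exact zero_le_one

lemma insensitive_knowledge (ht : 0 ≤ t) (hij : i ≠ j) :
    Insensitive t j i fun e : EventSequence N => e.knowledge i t :=
  fun _ _ he _ h => h.knowledge_eq_of_lastTime ht he hij

lemma insensitive_latest (ht : 0 ≤ t) (hij : i ≠ j) (k : Fin N) :
    Insensitive t j i (latest t k i) := fun e e' he he' h => by
  have := insensitive_knowledge ht hij e e' he he' h
  simp only at this
  simp only [latest, this]

lemma insensitive_weight (ht : 0 ≤ t) (hij : i ≠ j) (k : Fin N) :
    Insensitive t j i (weight lam t k i) := fun e e' he he' h => by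
  simp only [weight, insensitive_latest ht hij k e e' he he' h]

lemma insensitive_x (hkj : k ≠ j) (t s : ℝ) :
    Insensitive t j i fun e : EventSequence N => e.x k s := fun e e' _ _ h => by
  simp only [x_congr (h.lifetime_eq k hkj) (h.value_eq k hkj)]

/-- Agreement includes the time `latest` itself, so the value of `j` seen there is preserved when `k
= j`. For negative `latest` the weight removes a meaningless value. -/
lemma insensitive_prediction (ht : 0 ≤ t) (hij : i ≠ j) (k : Fin N) :
    Insensitive t j i (prediction lam t k i) := fun e e' he he' h => by
  have hw := insensitive_weight (lam := lam) ht hij k e e' he he' h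
  have hl := insensitive_latest ht hij k e e' he he' h
  unfold prediction
  rw [hw, hl]
  by_cases h0 : 0 ≤ latest t k i e
  · by_cases hk : k = j
    · subst hk
      rw [h.x_eq _ h0 le_rfl]
    · rw [x_congr (h.lifetime_eq k hk) (h.value_eq k hk)]
  · simp [weight, h0]

lemma insensitive_predictionError (ht : 0 ≤ t) (hij : i ≠ j) (hkj : k ≠ j) :
    Insensitive t j i (predictionError lam t k i) := fun e e' he he' h => by
  have h1 := insensitive_x (i := i) hkj t t e e' he he' h
  simp only at h1
  simp only [predictionError, h1, insensitive_prediction ht hij k e e' he he' h]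

/-- Indicator that `i` has some information about the agent present at time `t` with label `j`. -/
noncomputable def isCurrent (t : ℝ) (j i : Fin N) (e : EventSequence N) : ℝ :=
  if 0 ≤ latest t j i e ∧ t < e.arrival j (e.incarnation j (latest t j i e) + 1) then 1 else 0

lemma measurable_isCurrent (t : ℝ) (j i : Fin N) :
    Measurable (isCurrent t j i) := by
  have h := measurable_lastTime_knowledge t j i
  refine Measurable.ite ((measurableSet_le measurable_const h).inter ?_) measurable_const
    measurable_const
  exact measurableSet_lt measurable_const (measurable_countable_select
    (measurable_incarnation j h) fun n => measurable_arrival j (n + 1))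

lemma isCurrent_mem (t : ℝ) (j i : Fin N) (e : EventSequence N) :
    isCurrent t j i e = 0 ∨ isCurrent t j i e = 1 := by
  unfold isCurrent; split_ifs <;> simp

lemma Regular.isCurrent_eq_zero (he : e.Regular) {n : ℕ} (h : latest t j i e < e.arrival j n)
    (hn : e.arrival j n ≤ t) : isCurrent t j i e = 0 := by
  refine if_neg fun ⟨h0, h1⟩ => ?_
  have := (he.incarnation_lt_iff j h0 n).2 h
  linarith [(he.arrival_strictMono j).monotone (Nat.succ_le_of_lt this)]

/-- If the agent seen is still present, its value then and now are the same. The two summands get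
their randomness from different sources: a lifetime in the first, a value never communicated to `i`
in the second. -/
lemma Regular.predictionError_eq (he : e.Regular) (ht : 0 ≤ t) :
    predictionError lam t j i e =
      e.x j (latest t j i e) * (isCurrent t j i e - weight lam t j i e) +
      (1 - isCurrent t j i e) * e.x j t := by
  unfold isCurrent
  split_ifs with h
  · have h1 : e.incarnation j (latest t j i e) = e.incarnation j t := by
      symm
      rw [he.incarnation_eq_iff j ht]
      exact ⟨(e.lastArrival_le j h.1).trans (lastTime_le ht), h.2⟩
    have h2 : e.x j (latest t j i e) = e.x j t := by unfold x; rw [h1]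
    rw [predictionError, prediction, h2]
    ring
  · rw [predictionError, prediction]
    ring

end EventSequence

/-! ### Orthogonality of the prediction errors -/

namespace IsOpenSystem

open EventSequence

variable {Ω : Type*} [MeasurableSpace Ω] {μ : Measure Ω} [IsProbabilityMeasure μ] {N : ℕ}
  {e : Ω → EventSequence N} {lam sig : ℝ}

lemma memLp_prediction (he : IsOpenSystem μ e lam sig) (hlam : 0 < lam) {t : ℝ} (ht : 0 ≤ t)
    (j i : Fin N) : MemLp (fun ω => prediction lam t j i (e ω)) 2 μ := by
  refine (he.memLp_x j (measurable_lastTime_knowledge t j i) (valueFree_lastTime t j i)).mono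
    ((measurable_prediction lam t j i).comp he.measurable).aestronglyMeasurable
    (ae_of_all _ fun ω => ?_)
  rw [prediction, norm_mul, Real.norm_of_nonneg (weight_nonneg _ _ _ _ _)]
  exact mul_le_of_le_one_left (norm_nonneg _) (weight_le_one hlam ht _ _ _)

lemma memLp_x_const (he : IsOpenSystem μ e lam sig) (j : Fin N) (t : ℝ) :
    MemLp (fun ω => (e ω).x j t) 2 μ :=
  he.memLp_x j (θ := fun _ => t) measurable_const fun _ _ _ _ _ => rfl

lemma memLp_predictionError (he : IsOpenSystem μ e lam sig) (hlam : 0 < lam) {t : ℝ} (ht : 0 ≤ t)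
    (j i : Fin N) : MemLp (fun ω => predictionError lam t j i (e ω)) 2 μ :=
  (he.memLp_x_const j t).sub (he.memLp_prediction hlam ht j i)

/-- Whether the agent with label `j` has been replaced since the most recent information is
independent of everything that `i` knows. -/
lemma integral_current_part (he : IsOpenSystem μ e lam sig) (hlam : 0 < lam) {t : ℝ} (ht : 0 ≤ t)
    {i j : Fin N} (hij : i ≠ j) {Y : EventSequence N → ℝ} (hY : Measurable Y)
    (hYi : Insensitive t j i Y)
    (hint : Integrable (fun ω => (e ω).x j (latest t j i (e ω)) *
      (isCurrent t j i (e ω) - weight lam t j i (e ω)) * Y (e ω)) μ) :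
    ∫ ω, (e ω).x j (latest t j i (e ω)) *
      (isCurrent t j i (e ω) - weight lam t j i (e ω)) * Y (e ω) ∂μ = 0 := by
  have hlat := measurable_lastTime_knowledge t j i
  have hk : Measurable fun ω => (e ω).incarnation j (latest t j i (e ω)) :=
    (measurable_incarnation j hlat).comp he.measurable
  refine integral_eq_zero_of_fibers hk hint fun n => ?_
  set c : EventSequence N → ℝ := fun w =>
    if w.arrival j n ≤ latest t j i w then w.value j n * Y w else 0 with hc
  -- Here `z.1` is the true lifetime of the `n`-th agent and `z.2` the sequence with that lifetime
  -- overwritten. The two indicators say that this agent survives past `t` and past `latest`.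
  set φ : ℝ × EventSequence N → ℝ := fun z => c z.2 *
    ((if t < z.2.arrival j n + z.1 then 1 else 0) -
      weight lam t j i z.2 * (if latest t j i z.2 < z.2.arrival j n + z.1 then 1 else 0)) with hφ
  have hA := measurable_arrival (N := N) j n
  have hcm : Measurable c :=
    Measurable.ite (measurableSet_le hA hlat) ((EventSequence.measurable_value j n).mul hY) measurable_const
  have hφm : Measurable φ := by
    refine (hcm.comp measurable_snd).mul (Measurable.sub ?_
      (((measurable_weight lam t j i).comp measurable_snd).mul ?_))
    · exact Measurable.ite (measurableSet_lt measurable_const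
        ((hA.comp measurable_snd).add measurable_fst)) measurable_const measurable_const
    · exact Measurable.ite (measurableSet_lt (hlat.comp measurable_snd)
        ((hA.comp measurable_snd).add measurable_fst)) measurable_const measurable_const
  -- The length `t + 1` is positive and keeps the `n`-th agent present beyond `t`, hence beyond
  -- `latest`.
  have hupd : Measurable fun ω => updLifetime j n (t + 1) (e ω) :=
    (measurable_updLifetime j n (t + 1)).comp he.measurable
  have hcongr : ((fun ω => (e ω).incarnation j (latest t j i (e ω))) ⁻¹' {n}).indicator
      (fun ω => (e ω).x j (latest t j i (e ω)) *
        (isCurrent t j i (e ω) - weight lam t j i (e ω)) * Y (e ω)) =ᵐ[μ]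
      fun ω => φ ((e ω).lifetime j n, updLifetime j n (t + 1) (e ω)) := by
    filter_upwards [he.ae_regular hlam] with ω hreg
    set w := updLifetime j n (t + 1) (e ω)
    have hwreg : w.Regular := hreg.updLifetime (by linarith)
    have hAw : w.arrival j n = (e ω).arrival j n := updLifetime_arrival_of_le le_rfl
    have hA0 := hreg.arrival_nonneg j n
    have hlt : latest t j i (e ω) ≤ t := lastTime_le ht
    simp only [hφ, hc, hAw]
    rw [← arrival_succ]
    by_cases h1 : latest t j i (e ω) < (e ω).arrival j (n + 1)
    · have hagree : AgreeUpTo j (latest t j i (e ω)) (e ω) w :=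
        agreeUpTo_updLifetime h1 (by linarith)
      rw [insensitive_latest ht hij j _ _ hreg hwreg hagree,
        insensitive_weight ht hij j _ _ hreg hwreg hagree, hYi _ _ hreg hwreg hagree, if_pos h1]
      by_cases h2 : (e ω).arrival j n ≤ latest t j i (e ω)
      · have h0 : 0 ≤ latest t j i (e ω) := hA0.trans h2
        have hinc : (e ω).incarnation j (latest t j i (e ω)) = n :=
          (hreg.incarnation_eq_iff j h0 n).2 ⟨h2, h1⟩
        rw [indicator_of_mem (show ω ∈ _ from hinc), if_pos h2]
        change (e ω).value j _ * _ * _ = (e ω).value j n * _ * _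
        rw [isCurrent, hinc]
        simp only [h0, true_and]
        ring
      -- A negative `latest` (no information) also has an incarnation number, but there `isCurrent`
      -- and `weight` both vanish.
      · rw [if_neg h2, zero_mul, indicator_apply_eq_zero]
        intro hinc
        have hinc : (e ω).incarnation j (latest t j i (e ω)) = n := hinc
        have h0 : ¬ 0 ≤ latest t j i (e ω) := fun h0 =>
          h2 ((hreg.incarnation_eq_iff j h0 n).1 hinc).1
        simp [isCurrent, weight, h0]
    -- If the overwritten sequence had its `latest` before the true arrival `n + 1`, the two
    -- sequences would agree up to that time and `latest` would be the same for both, against `h1`.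
    -- So both indicators in `φ` are `0`.
    · have h2 : ¬ latest t j i w < (e ω).arrival j (n + 1) := by
        intro h2
        have hagree : AgreeUpTo j (latest t j i w) w (e ω) :=
          (agreeUpTo_updLifetime h2 (by linarith)).symm
        rw [← insensitive_latest ht hij j _ _ hwreg hreg hagree] at h2
        exact h1 h2
      have h3 : ¬ t < (e ω).arrival j (n + 1) := by
        rw [not_lt] at h2 ⊢; linarith
      rw [if_neg h2, if_neg h3, mul_zero, sub_zero, mul_zero, indicator_apply_eq_zero]
      intro hinc
      have hinc : (e ω).incarnation j (latest t j i (e ω)) = n := hinc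
      have h0 : 0 ≤ latest t j i (e ω) := by
        rw [not_lt] at h1; linarith [hreg.arrival_nonneg j (n + 1)]
      exact absurd ((hreg.incarnation_eq_iff j h0 n).1 hinc).2 h1
  rw [integral_congr_ae hcongr]
  refine integral_eq_zero_of_indepFun (he.measurable_lifetime j n) hupd
    (he.indepFun_updLifetime j n (t + 1)) hφm ?_ ?_
  · exact (integrable_congr hcongr).1 (hint.indicator (hk (measurableSet_singleton n)))
  · filter_upwards [he.ae_regular hlam] with ω hreg
    set w := updLifetime j n (t + 1) (e ω)
    have hA0 : 0 ≤ w.arrival j n :=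
      (hreg.updLifetime (by linarith : 0 < t + 1)).arrival_nonneg j n
    rw [he.lifetime_law j n]
    simp only [hφ, hc]
    rw [integral_const_mul]
    split_ifs with h
    swap
    · simp
    have := isProbabilityMeasure_expMeasure hlam
    have hI : ∀ a : ℝ, (fun x : ℝ => if a < w.arrival j n + x then (1 : ℝ) else 0) =
        (Ioi (a - w.arrival j n)).indicator 1 := by
      intro a; funext x
      simp only [indicator, mem_Ioi, Pi.one_apply, sub_lt_iff_lt_add']
    have hint1 : ∀ a : ℝ, Integrable (fun x : ℝ => if a < w.arrival j n + x then (1 : ℝ) else 0)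
        (expMeasure lam) := by
      intro a
      rw [hI a]
      exact (integrable_const (1 : ℝ)).indicator measurableSet_Ioi
    have hval : ∀ a : ℝ, w.arrival j n ≤ a →
        ∫ x, (if a < w.arrival j n + x then (1 : ℝ) else 0) ∂(expMeasure lam) =
        Real.exp (-(lam * (a - w.arrival j n))) := by
      intro a ha
      rw [hI a, integral_indicator_one measurableSet_Ioi,
        expMeasure_real_Ioi hlam (sub_nonneg.2 ha)]
    -- Memorylessness: both survival probabilities are exponential tails, and `weight` is their
    -- ratio.
    rw [integral_sub (hint1 t) ((hint1 _).const_mul _), integral_const_mul, hval t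
      (h.trans (lastTime_le ht)), hval _ h, mul_eq_zero]
    right
    rw [weight, if_pos (hA0.trans h), ← Real.exp_add, sub_eq_zero]
    congr 1
    ring

end IsOpenSystem

namespace IsOpenSystem

open EventSequence

variable {Ω : Type*} [MeasurableSpace Ω] {μ : Measure Ω} [IsProbabilityMeasure μ] {N : ℕ}
  {e : Ω → EventSequence N} {lam sig : ℝ}

/-- The value of an agent about whom `i` has no information has mean zero, conditionally on
everything that `i` knows. -/
lemma integral_unknown_part (he : IsOpenSystem μ e lam sig) (hlam : 0 < lam) {t : ℝ} (ht : 0 ≤ t)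
    {i j : Fin N} {Y : EventSequence N → ℝ} (hY : Measurable Y)
    (hYi : Insensitive t j i Y)
    (hint : Integrable (fun ω => (1 - isCurrent t j i (e ω)) * (e ω).x j t * Y (e ω)) μ) :
    ∫ ω, (1 - isCurrent t j i (e ω)) * (e ω).x j t * Y (e ω) ∂μ = 0 := by
  have hlat := measurable_lastTime_knowledge t j i
  have hk : Measurable fun ω => (e ω).incarnation j t :=
    (measurable_incarnation j measurable_const).comp he.measurable
  refine integral_eq_zero_of_fibers hk hint fun n => ?_
  -- The event that the `n`-th agent is present at `t` and that `i` has no information as recent as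
  -- its arrival. It ignores the values.
  set c : EventSequence N → ℝ := fun w =>
    if latest t j i w < w.arrival j n ∧ w.arrival j n ≤ t ∧ t < w.arrival j (n + 1) then Y w
    else 0 with hc
  have hA := fun m => measurable_arrival (N := N) j m
  have hcm : Measurable c :=
    Measurable.ite ((measurableSet_lt hlat (hA n)).inter
      ((measurableSet_le (hA n) measurable_const).inter
        (measurableSet_lt measurable_const (hA (n + 1))))) hY measurable_const
  have hcongr : ((fun ω => (e ω).incarnation j t) ⁻¹' {n}).indicator
      (fun ω => (1 - isCurrent t j i (e ω)) * (e ω).x j t * Y (e ω)) =ᵐ[μ]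
      fun ω => (e ω).value j n * c (updValue j n 0 (e ω)) := by
    filter_upwards [he.ae_regular hlam] with ω hreg
    have hlw : latest t j i (updValue j n 0 (e ω)) = latest t j i (e ω) :=
      valueFree_lastTime t j i _ _ rfl rfl rfl
    have hAw : (updValue j n 0 (e ω)).arrival j = (e ω).arrival j := arrival_congr rfl
    simp only [hc, hlw, hAw]
    by_cases hinc : (e ω).incarnation j t = n
    · have hn := (hreg.incarnation_eq_iff j ht n).1 hinc
      rw [indicator_of_mem (show ω ∈ _ from hinc)]
      have hx : (e ω).x j t = (e ω).value j n := by rw [x, hinc]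
      by_cases hlt : latest t j i (e ω) < (e ω).arrival j n
      · rw [if_pos ⟨hlt, hn⟩, hreg.isCurrent_eq_zero hlt hn.1, hx,
          hYi _ _ hreg hreg.updValue (agreeUpTo_updValue hreg hlt)]
        ring
      -- Information at or after the arrival concerns the agent now present, so `1 - isCurrent` is
      -- `0`.
      · rw [if_neg fun h => hlt h.1]
        rw [not_lt] at hlt
        have h0 : 0 ≤ latest t j i (e ω) := (hreg.arrival_nonneg j n).trans hlt
        have hle : latest t j i (e ω) ≤ t := lastTime_le ht
        have hinc' : (e ω).incarnation j (latest t j i (e ω)) = n :=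
          (hreg.incarnation_eq_iff j h0 n).2 ⟨hlt, hle.trans_lt hn.2⟩
        rw [isCurrent, hinc', if_pos ⟨h0, hn.2⟩]
        ring
    · rw [indicator_of_notMem (show ω ∉ _ from hinc), if_neg, mul_zero]
      exact fun h => hinc ((hreg.incarnation_eq_iff j ht n).2 h.2)
  rw [integral_congr_ae hcongr]
  refine integral_eq_zero_of_indepFun (he.measurable_value j n)
    ((measurable_updValue j n 0).comp he.measurable)
    (he.indepFun_updValue j n 0) (φ := fun z => z.1 * c z.2)
    (measurable_fst.mul (hcm.comp measurable_snd)) ?_ (ae_of_all _ fun ω => ?_)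
  · exact (integrable_congr hcongr).1 (hint.indicator (hk (measurableSet_singleton n)))
  · simp only
    rw [integral_mul_const, integral_map (f := fun x => x) (he.measurable_value j n).aemeasurable
      aestronglyMeasurable_id, he.value_mean, zero_mul]

/-- The prediction errors are orthogonal to insensitive quantities. -/
lemma integral_predictionError_mul (he : IsOpenSystem μ e lam sig) (hlam : 0 < lam) {t : ℝ} (ht : 0 ≤ t)
    {i j : Fin N} (hij : i ≠ j) {Y : EventSequence N → ℝ} (hY : Measurable Y)
    (hYi : Insensitive t j i Y) (hY2 : MemLp (fun ω => Y (e ω)) 2 μ) :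
    ∫ ω, predictionError lam t j i (e ω) * Y (e ω) ∂μ = 0 := by
  have hlat := measurable_lastTime_knowledge t j i
  have hI1 : Integrable (fun ω => (e ω).x j (latest t j i (e ω)) *
      (isCurrent t j i (e ω) - weight lam t j i (e ω)) * Y (e ω)) μ := by
    refine MemLp.integrable_mul (p := 2) (q := 2) ?_ hY2
    refine (he.memLp_x j hlat (valueFree_lastTime t j i)).mono
      (((measurable_x j hlat).mul ((measurable_isCurrent t j i).sub
        (measurable_weight lam t j i))).comp he.measurable).aestronglyMeasurable
      (ae_of_all _ fun ω => ?_)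
    rw [norm_mul]
    refine mul_le_of_le_one_right (norm_nonneg _) ?_
    rw [Real.norm_eq_abs, abs_le]
    have h1 := weight_nonneg lam t j i (e ω)
    have h2 := weight_le_one hlam ht j i (e ω)
    rcases isCurrent_mem t j i (e ω) with h | h <;> rw [h] <;> constructor <;> linarith
  have hI2 : Integrable (fun ω => (1 - isCurrent t j i (e ω)) * (e ω).x j t * Y (e ω)) μ := by
    refine MemLp.integrable_mul (p := 2) (q := 2) ?_ hY2
    refine (he.memLp_x_const j t).mono
      (((measurable_const.sub (measurable_isCurrent t j i)).mul
        (measurable_x j measurable_const)).comp he.measurable).aestronglyMeasurable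
      (ae_of_all _ fun ω => ?_)
    rw [norm_mul]
    refine mul_le_of_le_one_left (norm_nonneg _) ?_
    rcases isCurrent_mem t j i (e ω) with h | h <;> simp [h]
  have hcongr : (fun ω => predictionError lam t j i (e ω) * Y (e ω)) =ᵐ[μ] fun ω =>
      (e ω).x j (latest t j i (e ω)) *
        (isCurrent t j i (e ω) - weight lam t j i (e ω)) * Y (e ω) +
      (1 - isCurrent t j i (e ω)) * (e ω).x j t * Y (e ω) := by
    filter_upwards [he.ae_regular hlam] with ω hreg
    rw [hreg.predictionError_eq ht]
    ring
  rw [integral_congr_ae hcongr, integral_add hI1 hI2,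
    he.integral_current_part hlam ht hij hY hYi hI1,
    he.integral_unknown_part hlam ht hY hYi hI2, add_zero]

/-- The mean squared error of the best prediction. -/
lemma integral_predictionError_sq (he : IsOpenSystem μ e lam sig) (hlam : 0 < lam) {t : ℝ} (ht : 0 ≤ t)
    {i j : Fin N} (hij : i ≠ j) :
    ∫ ω, predictionError lam t j i (e ω) ^ 2 ∂μ =
      sig ^ 2 * (1 - ∫ ω, weight lam t j i (e ω) ^ 2 ∂μ) := by
  have hx := he.memLp_x_const j t
  have hp := he.memLp_prediction hlam ht j i
  have hr := he.memLp_predictionError hlam ht j i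
  have h0 := he.integral_predictionError_mul hlam ht hij (measurable_prediction lam t j i)
    (insensitive_prediction ht hij j) hp
  have h1 : ∫ ω, (e ω).x j t ^ 2 ∂μ = sig ^ 2 := by
    have := he.integral_x_sq_mul j (θ := fun _ => t) measurable_const (fun _ _ _ _ _ => rfl)
      (g := fun _ => 1) measurable_const (fun _ _ _ _ _ => rfl) fun _ => zero_le_one
    simpa using this
  have h2 : ∫ ω, prediction lam t j i (e ω) ^ 2 ∂μ =
      sig ^ 2 * ∫ ω, weight lam t j i (e ω) ^ 2 ∂μ := by
    rw [← he.integral_x_sq_mul j (measurable_lastTime_knowledge t j i) (valueFree_lastTime t j i)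
      ((measurable_weight lam t j i).pow_const 2)
      (fun e e' h1 h2 h3 => by simp only [valueFree_weight lam t j i e e' h1 h2 h3])
      fun _ => sq_nonneg _]
    simp only [prediction, mul_pow, mul_comm]
  have h3 : ∫ ω, (e ω).x j t ^ 2 ∂μ = ∫ ω, (predictionError lam t j i (e ω) ^ 2 +
      2 * (predictionError lam t j i (e ω) * prediction lam t j i (e ω)) +
      prediction lam t j i (e ω) ^ 2) ∂μ := by
    congr 1; funext ω; rw [predictionError]; ring
  have hI : Integrable (fun ω => predictionError lam t j i (e ω) * prediction lam t j i (e ω)) μ :=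
    hr.integrable_mul hp
  have hI' : Integrable (fun ω => predictionError lam t j i (e ω) ^ 2 +
      2 * (predictionError lam t j i (e ω) * prediction lam t j i (e ω))) μ :=
    hr.integrable_sq.add (hI.const_mul 2)
  rw [integral_add hI' hp.integrable_sq,
    integral_add hr.integrable_sq (hI.const_mul 2), integral_const_mul, h0, h1, h2] at h3
  linarith

/-- The mean squared error of agent `i` is at least that of the best predictions of the values of the
other agents. -/
lemma le_integral_sq (he : IsOpenSystem μ e lam sig) (hlam : 0 < lam) {t : ℝ} (ht : 0 ≤ t)
    (i : Fin N) {g : Set (Info N) → ℝ} (hg : @Measurable _ _ (knowledgeSigmaAlgebra N) _ g)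
    (hD : MemLp (fun ω => ∑ k, (e ω).x k t - g ((e ω).knowledge i t)) 2 μ) :
    ∑ j ∈ Finset.univ.erase i, ∫ ω, predictionError lam t j i (e ω) ^ 2 ∂μ ≤
      ∫ ω, (∑ k, (e ω).x k t - g ((e ω).knowledge i t)) ^ 2 ∂μ := by
  set S := (Finset.univ.erase i : Finset (Fin N)) with hS
  set D : EventSequence N → ℝ := fun e => ∑ k, e.x k t - g (e.knowledge i t) with hDdef
  set R : EventSequence N → ℝ := fun e => ∑ j ∈ S, predictionError lam t j i e with hR
  have hgm : Measurable fun e : EventSequence N => g (e.knowledge i t) :=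
    @Measurable.comp _ _ _ _ (knowledgeSigmaAlgebra N) _ _ _ hg (measurable_knowledge i t)
  have hDm : Measurable D :=
    (Finset.measurable_fun_sum _ fun k _ => measurable_x k measurable_const).sub hgm
  have hr := fun j => he.memLp_predictionError hlam ht j i
  have hR2 : MemLp (fun ω => R (e ω)) 2 μ := memLp_finsetSum _ fun j _ => hr j
  have key : ∀ j ∈ S, ∫ ω, predictionError lam t j i (e ω) * (D (e ω) - R (e ω)) ∂μ = 0 := by
    intro j hj
    have hij : i ≠ j := fun h => by simp [hS, h] at hj
    refine he.integral_predictionError_mul hlam ht hij (Y := fun e => D e - R e)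
      (hDm.sub (Finset.measurable_fun_sum _ fun k _ => measurable_predictionError lam t k i)) ?_
      (hD.sub hR2)
    intro e₁ e₂ h1 h2 h
    -- Subtracting the errors replaces the value of each other agent by its prediction. What remains
    -- involves only `i` itself, its knowledge and predictions, all insensitive to the later life of
    -- `j`.
    have hsplit : ∀ e : EventSequence N, D e - R e =
        e.x i t + ∑ k ∈ S, prediction lam t k i e - g (e.knowledge i t) := by
      intro e
      simp only [hDdef, hR, predictionError, Finset.sum_sub_distrib]
      rw [← Finset.add_sum_erase _ _ (Finset.mem_univ i), ← hS]
      ring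
    have hK := insensitive_knowledge ht hij e₁ e₂ h1 h2 h
    have hX := insensitive_x (i := i) hij t t e₁ e₂ h1 h2 h
    simp only at hK hX
    simp only [hsplit, hK, hX, insensitive_prediction ht hij _ e₁ e₂ h1 h2 h]
  -- Cross terms vanish because the error for `k ≠ j` is itself insensitive with respect to `j`.
  have hdiag : ∀ j ∈ S, ∫ ω, predictionError lam t j i (e ω) * R (e ω) ∂μ =
      ∫ ω, predictionError lam t j i (e ω) ^ 2 ∂μ := by
    intro j hj
    have hij : i ≠ j := fun h => by simp [hS, h] at hj
    have h1 : ∀ ω, predictionError lam t j i (e ω) * R (e ω) =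
        predictionError lam t j i (e ω) ^ 2 + predictionError lam t j i (e ω) *
          ∑ k ∈ S.erase j, predictionError lam t k i (e ω) := by
      intro ω
      simp only [hR]
      rw [← Finset.add_sum_erase _ _ hj]
      ring
    have hrest : MemLp (fun ω => ∑ k ∈ S.erase j, predictionError lam t k i (e ω)) 2 μ :=
      memLp_finsetSum _ fun k _ => hr k
    simp only [h1]
    have h2 : ∫ ω, predictionError lam t j i (e ω) *
        ∑ k ∈ S.erase j, predictionError lam t k i (e ω) ∂μ = 0 := by
      refine he.integral_predictionError_mul hlam ht hij
        (Y := fun e => ∑ k ∈ S.erase j, predictionError lam t k i e)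
        (Finset.measurable_fun_sum _ fun k _ => measurable_predictionError lam t k i) ?_ hrest
      intro e₁ e₂ h1 h2 h
      refine Finset.sum_congr rfl fun k hk => ?_
      exact insensitive_predictionError ht hij (Finset.ne_of_mem_erase hk) e₁ e₂ h1 h2 h
    have h3 : Integrable (fun ω => predictionError lam t j i (e ω) *
        ∑ k ∈ S.erase j, predictionError lam t k i (e ω)) μ := (hr j).integrable_mul hrest
    rw [integral_add (hr j).integrable_sq h3, h2, add_zero]
  have hDR : ∫ ω, R (e ω) * (D (e ω) - R (e ω)) ∂μ = 0 := by
    have h1 : ∀ ω, R (e ω) * (D (e ω) - R (e ω)) =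
        ∑ j ∈ S, predictionError lam t j i (e ω) * (D (e ω) - R (e ω)) := fun ω => by
      rw [← Finset.sum_mul]
    have h2 : ∀ j ∈ S, Integrable
        (fun ω => predictionError lam t j i (e ω) * (D (e ω) - R (e ω))) μ :=
      fun j _ => (hr j).integrable_mul (hD.sub hR2)
    simp only [h1]
    rw [integral_finsetSum _ h2]
    exact Finset.sum_eq_zero key
  have hRR : ∫ ω, R (e ω) ^ 2 ∂μ = ∑ j ∈ S, ∫ ω, predictionError lam t j i (e ω) ^ 2 ∂μ := by
    have : ∀ ω, R (e ω) ^ 2 = ∑ j ∈ S, predictionError lam t j i (e ω) * R (e ω) := fun ω => by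
      rw [sq, ← Finset.sum_mul]
    have h2 : ∀ j ∈ S, Integrable (fun ω => predictionError lam t j i (e ω) * R (e ω)) μ :=
      fun j _ => (hr j).integrable_mul hR2
    simp only [this]
    rw [integral_finsetSum _ h2]
    exact Finset.sum_congr rfl hdiag
  rw [← hRR]
  have hI : Integrable (fun ω => R (e ω) * (D (e ω) - R (e ω))) μ :=
    hR2.integrable_mul (hD.sub hR2)
  have hexp : ∫ ω, D (e ω) ^ 2 ∂μ = ∫ ω, (R (e ω) ^ 2 + 2 * (R (e ω) * (D (e ω) - R (e ω))) +
      (D (e ω) - R (e ω)) ^ 2) ∂μ := by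
    congr 1; funext ω; ring
  change _ ≤ ∫ ω, D (e ω) ^ 2 ∂μ
  have hI' : Integrable (fun ω => R (e ω) ^ 2 + 2 * (R (e ω) * (D (e ω) - R (e ω)))) μ :=
    hR2.integrable_sq.add (hI.const_mul 2)
  have hI2 : Integrable (fun ω => (D (e ω) - R (e ω)) ^ 2) μ := (hD.sub hR2).integrable_sq
  rw [hexp, integral_add hI' hI2,
    integral_add hR2.integrable_sq (hI.const_mul 2), integral_const_mul, hDR]
  have : 0 ≤ ∫ ω, (D (e ω) - R (e ω)) ^ 2 ∂μ := integral_nonneg fun _ => sq_nonneg _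
  linarith

/-- Lower bound on the expected mean squared error at time `t`, in terms of the expected weights. -/
lemma ofReal_le_lintegral_mse (he : IsOpenSystem μ e lam sig) (hN : 0 < N) (hlam : 0 < lam) {t : ℝ}
    (ht : 0 ≤ t) {alg : Fin N → ℝ → Set (Info N) → ℝ}
    (halg : ∀ i, @Measurable _ _ (knowledgeSigmaAlgebra N) _ (alg i t)) {I : ℝ}
    (hI : ∀ i j : Fin N, i ≠ j → ∫ ω, weight lam t j i (e ω) ^ 2 ∂μ ≤ I) :
    ENNReal.ofReal (((N : ℝ) - 1) / (N : ℝ) ^ 2 * (1 - I) * sig ^ 2) ≤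
      ∫⁻ ω, ENNReal.ofReal ((e ω).mse alg t) ∂μ := by
  have hN0 : (0 : ℝ) < N := by exact_mod_cast hN
  set b : ℝ := ((N : ℝ) - 1) * (1 - I) * sig ^ 2 with hb
  have hgm : ∀ i, Measurable fun e : EventSequence N => alg i t (e.knowledge i t) := fun i =>
    @Measurable.comp _ _ _ _ (knowledgeSigmaAlgebra N) _ _ _ (halg i) (measurable_knowledge i t)
  have hmeas : ∀ i, Measurable fun ω => (e ω).average t - alg i t ((e ω).knowledge i t) :=
    fun i => ((measurable_average t).sub (hgm i)).comp he.measurable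
  have hagent : ∀ i, ENNReal.ofReal (b / (N : ℝ) ^ 2) ≤ ∫⁻ ω, ENNReal.ofReal
      (((e ω).average t - alg i t ((e ω).knowledge i t)) ^ 2) ∂μ := by
    intro i
    -- The estimate need not be square integrable; if the error is not, its second moment is `⊤` and
    -- the bound is trivial.
    by_cases hfin : MemLp (fun ω => (e ω).average t - alg i t ((e ω).knowledge i t)) 2 μ
    · rw [← ofReal_integral_eq_lintegral_ofReal hfin.integrable_sq (ae_of_all _ fun _ => sq_nonneg _)]
      refine ENNReal.ofReal_le_ofReal ?_
      have heq : ∀ ω, ∑ k, (e ω).x k t - N * alg i t ((e ω).knowledge i t) =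
          N * ((e ω).average t - alg i t ((e ω).knowledge i t)) := fun ω => by
        rw [EventSequence.average]; field_simp
      have hD : MemLp (fun ω => ∑ k, (e ω).x k t - N * alg i t ((e ω).knowledge i t)) 2 μ := by
        simp only [heq]
        exact hfin.const_mul _
      have hle := he.le_integral_sq hlam ht i (g := fun K => N * alg i t K)
        (@Measurable.comp _ _ _ (knowledgeSigmaAlgebra N) _ _ _ _
          (measurable_const_mul (N : ℝ)) (halg i)) hD
      simp only [heq, mul_pow] at hle
      rw [integral_const_mul] at hle
      rw [div_le_iff₀' (by positivity)]
      refine le_trans ?_ hle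
      have hcard : ((Finset.univ.erase i).card : ℝ) = N - 1 := by
        rw [Finset.card_erase_of_mem (Finset.mem_univ i), Finset.card_univ, Fintype.card_fin,
          Nat.cast_sub hN, Nat.cast_one]
      calc b = ∑ j ∈ Finset.univ.erase i, sig ^ 2 * (1 - I) := by
            rw [Finset.sum_const, nsmul_eq_mul, hcard, hb]; ring
        _ ≤ _ := by
            refine Finset.sum_le_sum fun j hj => ?_
            have hij : i ≠ j := (Finset.ne_of_mem_erase hj).symm
            rw [he.integral_predictionError_sq hlam ht hij]
            exact mul_le_mul_of_nonneg_left (by linarith [hI i j hij]) (sq_nonneg _)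
    · have htop : ∫⁻ ω, ENNReal.ofReal
          (((e ω).average t - alg i t ((e ω).knowledge i t)) ^ 2) ∂μ = ⊤ := by
        by_contra hne
        refine hfin ((memLp_two_iff_integrable_sq (hmeas i).aestronglyMeasurable).2
          ⟨((hmeas i).pow_const 2).aestronglyMeasurable, ?_⟩)
        rw [hasFiniteIntegral_iff_ofReal (ae_of_all _ fun _ => sq_nonneg _)]
        exact lt_top_iff_ne_top.2 hne
      rw [htop]; exact le_top
  have hmse : ∀ ω, ENNReal.ofReal ((e ω).mse alg t) = ENNReal.ofReal (1 / N) *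
      ∑ i, ENNReal.ofReal (((e ω).average t - alg i t ((e ω).knowledge i t)) ^ 2) := fun ω => by
    rw [mse, ENNReal.ofReal_mul (by positivity), ENNReal.ofReal_sum_of_nonneg fun _ _ => sq_nonneg _]
  simp only [hmse]
  have hm2 := fun i => ((hmeas i).pow_const 2).ennreal_ofReal
  rw [lintegral_const_mul _ (Finset.measurable_fun_sum _ fun i _ => hm2 i),
    lintegral_finsetSum _ fun i _ => hm2 i]
  calc ENNReal.ofReal (((N : ℝ) - 1) / (N : ℝ) ^ 2 * (1 - I) * sig ^ 2)
      = ENNReal.ofReal (1 / N) * ∑ _i : Fin N, ENNReal.ofReal (b / (N : ℝ) ^ 2) := by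
        rw [Finset.sum_const, Finset.card_univ, Fintype.card_fin, nsmul_eq_mul, ← mul_assoc,
          ← ENNReal.ofReal_natCast, ← ENNReal.ofReal_mul (by positivity),
          one_div_mul_cancel hN0.ne', ENNReal.ofReal_one, one_mul]
        congr 1
        rw [hb]; ring
    _ ≤ _ := by
        gcongr with i
        exact hagent i

end IsOpenSystem

/-! ### The law of the age and the expected squared weight -/

/-- Exchanges happen at positive times only. This settles `t = 0`, where nothing is assumed about
the pseudo-CDF. -/
lemma EventSequence.Regular.latest_zero {N : ℕ} {e : EventSequence N} (he : e.Regular)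
    {i j : Fin N} (hij : i ≠ j) : EventSequence.latest 0 j i e < 0 := by
  have hcount : e.exchCount 0 = 0 := Nat.le_zero.1 (Nat.sInf_le he.exchTime_pos)
  have hK : e.knowledge i 0 = {Sum.inl (e.x i 0, i, 0)} := by
    rw [EventSequence.knowledge, hcount]
    exact if_neg (not_lt.2 (e.lastArrival_le i le_rfl))
  have : EventSequence.latest 0 j i e ≤ -1 := by
    rw [EventSequence.latest, lastTime_le_iff, hK]
    refine ⟨le_rfl, ?_⟩
    rintro s ⟨v, hv⟩
    simp only [mem_singleton_iff, Sum.inl.injEq, Prod.mk.injEq] at hv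
    exact absurd hv.2.1.symm hij
  linarith

namespace IsOpenSystem

open EventSequence

variable {Ω : Type*} [MeasurableSpace Ω] {μ : Measure Ω} {N : ℕ}
  {e : Ω → EventSequence N} {lam sig : ℝ}

lemma integral_weight_sq_zero (he : IsOpenSystem μ e lam sig) (hlam : 0 < lam) {i j : Fin N}
    (hij : i ≠ j) : ∫ ω, weight lam 0 j i (e ω) ^ 2 ∂μ = 0 := by
  refine integral_eq_zero_of_ae ?_
  filter_upwards [he.ae_regular hlam] with ω hreg
  simp [weight, not_le.2 (hreg.latest_zero hij)]

lemma pseudoCDF_eq (he : IsOpenSystem μ e lam sig) (hlam : 0 < lam) {t : ℝ} (ht : 0 ≤ t)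
    (j i : Fin N) (s : ℝ) : pseudoCDF μ e j i t s =
      μ.real {ω | 0 ≤ latest t j i (e ω) ∧ t - latest t j i (e ω) ≤ s} := by
  refine measureReal_congr ?_
  filter_upwards [he.ae_regular hlam] with ω hreg
  exact propext (hreg.age_le_iff ht j i s)

lemma pseudoCDF_of_neg (he : IsOpenSystem μ e lam sig) (hlam : 0 < lam) {t : ℝ} (ht : 0 ≤ t)
    (j i : Fin N) {s : ℝ} (hs : s < 0) : pseudoCDF μ e j i t s = 0 := by
  have : {ω | 0 ≤ latest t j i (e ω) ∧ t - latest t j i (e ω) ≤ s} = ∅ := by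
    refine eq_empty_of_forall_notMem fun ω hω => ?_
    have h1 : latest t j i (e ω) ≤ t := lastTime_le ht
    have h2 : t - latest t j i (e ω) ≤ s := hω.2
    linarith
  rw [he.pseudoCDF_eq hlam ht, this, measureReal_empty]

/-- The pseudo-CDF is `0` on negative ages and continuous at `0`, so age `0` carries no mass. This
removes a boundary term in the integration by parts. -/
lemma pseudoCDF_zero (he : IsOpenSystem μ e lam sig) (hlam : 0 < lam) {t : ℝ} (ht : 0 ≤ t)
    (j i : Fin N) (hac : AbsolutelyContinuousOnInterval (pseudoCDF μ e j i t) (-1) 1) :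
    pseudoCDF μ e j i t 0 = 0 := by
  have hc : ContinuousAt (pseudoCDF μ e j i t) 0 :=
    hac.continuousOn.continuousAt (by
      rw [uIcc_of_le (by norm_num)]
      exact Icc_mem_nhds (by norm_num) (by norm_num))
  have h1 : Tendsto (pseudoCDF μ e j i t) (nhdsWithin 0 (Iio 0)) (nhds 0) := by
    refine tendsto_const_nhds.congr' ?_
    filter_upwards [self_mem_nhdsWithin] with s hs
    exact (he.pseudoCDF_of_neg hlam ht j i hs).symm
  exact tendsto_nhds_unique (hc.tendsto.mono_left nhdsWithin_le_nhds) h1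

lemma integral_exp_window {lam : ℝ} (t b : ℝ) :
    ∫ u in (0 : ℝ)..b, 2 * lam * Real.exp (-2 * lam * (t - u)) =
      Real.exp (-2 * lam * (t - b)) - Real.exp (-2 * lam * t) := by
  have hd : ∀ u ∈ uIcc 0 b, HasDerivAt (fun u => Real.exp (-2 * lam * (t - u)))
      (2 * lam * Real.exp (-2 * lam * (t - u))) u := by
    intro u _
    have h1 : HasDerivAt (fun u => -2 * lam * (t - u)) (-2 * lam * (-1)) u :=
      ((hasDerivAt_id u).const_sub t).const_mul _
    convert h1.exp using 1
    ring
  rw [intervalIntegral.integral_eq_sub_of_hasDerivAt hd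
    ((by fun_prop : Continuous _).intervalIntegrable _ _)]
  simp

variable [IsProbabilityMeasure μ]

lemma pseudoCDF_monotone (j i : Fin N) (t : ℝ) : Monotone (pseudoCDF μ e j i t) :=
  fun _ _ h => measureReal_mono fun _ hω => le_trans hω (EReal.coe_le_coe_iff.2 h)

/-- The expected squared weight, as an integral against the distribution function of the age. -/
lemma integral_weight_sq_eq_cdf (he : IsOpenSystem μ e lam sig) (hlam : 0 < lam) {t : ℝ}
    (ht : 0 ≤ t) (j i : Fin N) :
    ∫ ω, weight lam t j i (e ω) ^ 2 ∂μ =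
      pseudoCDF μ e j i t t * Real.exp (-2 * lam * t) +
      ∫ s in (0 : ℝ)..t, pseudoCDF μ e j i t s * (2 * lam * Real.exp (-2 * lam * s)) := by
  set F := pseudoCDF μ e j i t with hF
  set τ : Ω → ℝ := fun ω => latest t j i (e ω) with hτ
  have hτm : Measurable τ := (measurable_lastTime_knowledge t j i).comp he.measurable
  have hτt : ∀ ω, τ ω ≤ t := fun ω => lastTime_le ht
  -- The derivative in `u` of `exp (-2 * lam * (t - u))`, the squared weight when `latest` is `u ≥
  -- 0`.
  set g : ℝ → ℝ := fun u => 2 * lam * Real.exp (-2 * lam * (t - u)) with hg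
  have hg0 : ∀ u, 0 ≤ g u := fun u => by positivity
  have hgc : Continuous g := by fun_prop
  set m : Ω → ℝ := fun ω => max (τ ω) 0 with hm
  have hmm : Measurable m := hτm.max measurable_const
  have hm0 : ∀ ω, 0 ≤ m ω := fun ω => le_max_right _ _
  have hmt : ∀ ω, m ω ≤ t := fun ω => max_le (hτt ω) ht
  have hGint : ∀ ω, ∫ u in (0 : ℝ)..m ω, g u =
      Real.exp (-2 * lam * (t - m ω)) - Real.exp (-2 * lam * t) := fun ω =>
    integral_exp_window t (m ω)
  have hA : MeasurableSet {ω | 0 ≤ τ ω} := measurableSet_le measurable_const hτm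
  -- The squared weight jumps from `0` to `exp (-2 * lam * t)` at `τ = 0` and then grows with
  -- derivative `g`. The indicator carries the jump; truncating `τ` at `0` makes the integral vanish
  -- without information.
  have hw : ∀ ω, weight lam t j i (e ω) ^ 2 =
      {ω | 0 ≤ τ ω}.indicator (fun _ => Real.exp (-2 * lam * t)) ω +
        ∫ u in (0 : ℝ)..m ω, g u := by
    intro ω
    rw [hGint, weight]
    by_cases h : 0 ≤ τ ω
    · rw [indicator_of_mem (show ω ∈ {ω | 0 ≤ τ ω} from h), if_pos h, hm]
      simp only [max_eq_left h]
      rw [← Real.exp_nat_mul]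
      have : ((2 : ℕ) : ℝ) * -(lam * (t - latest t j i (e ω))) = -2 * lam * (t - τ ω) := by
        push_cast; ring
      rw [this]
      ring
    · rw [indicator_of_notMem (show ω ∉ {ω | 0 ≤ τ ω} from h), if_neg h, hm]
      simp only [max_eq_right (not_le.1 h).le]
      simp
  have hGm : Measurable fun ω => ∫ u in (0 : ℝ)..m ω, g u := by
    simp only [hGint]; fun_prop
  have hG0 : ∀ ω, 0 ≤ ∫ u in (0 : ℝ)..m ω, g u := fun ω =>
    intervalIntegral.integral_nonneg (hm0 ω) fun u _ => hg0 u
  have hGI : Integrable (fun ω => ∫ u in (0 : ℝ)..m ω, g u) μ := by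
    refine Integrable.of_bound hGm.aestronglyMeasurable 1 (ae_of_all _ fun ω => ?_)
    rw [Real.norm_of_nonneg (hG0 ω), hGint]
    have h1 : Real.exp (-2 * lam * (t - m ω)) ≤ 1 := by
      rw [Real.exp_le_one_iff]
      have := mul_nonneg hlam.le (sub_nonneg.2 (hmt ω))
      linarith
    linarith [Real.exp_pos (-2 * lam * t)]
  have hFm : ∀ u, 0 < u → μ {ω | u ≤ m ω} = ENNReal.ofReal (F (t - u)) := by
    intro u hu
    rw [hF, he.pseudoCDF_eq hlam ht, ofReal_measureReal]
    congr 1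
    ext ω
    simp only [mem_ofPred_eq, hm, le_max_iff, not_le.2 hu, or_false]
    exact ⟨fun h => ⟨hu.le.trans h, by linarith [show u ≤ latest t j i (e ω) from h]⟩,
      fun h => by have := h.2; change u ≤ latest t j i (e ω); linarith⟩
  have hFmono : Monotone F := pseudoCDF_monotone j i t
  have hFmeas : Measurable F := hFmono.measurable
  have hF0 : ∀ s, 0 ≤ F s := fun s => measureReal_nonneg
  have hFg : Measurable fun u => F (t - u) * g u :=
    (hFmeas.comp (measurable_id.const_sub t)).mul hgc.measurable
  -- Layer cake: `u ≤ m` means, for `u > 0`, that the age is at most `t - u`.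
  have hlc : ∫ ω, (∫ u in (0 : ℝ)..m ω, g u) ∂μ = ∫ u in Ioi 0, F (t - u) * g u := by
    rw [integral_eq_lintegral_of_nonneg_ae (ae_of_all _ hG0) hGm.aestronglyMeasurable,
      lintegral_comp_eq_lintegral_meas_le_mul μ (ae_of_all _ hm0) hmm.aemeasurable
        (fun u _ => hgc.intervalIntegrable _ _) (ae_of_all _ hg0),
      integral_eq_lintegral_of_nonneg_ae (ae_of_all _ fun u => mul_nonneg (hF0 _) (hg0 _))
        hFg.aestronglyMeasurable]
    congr 1
    refine setLIntegral_congr_fun measurableSet_Ioi fun u hu => ?_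
    rw [hFm u hu, ENNReal.ofReal_mul (hF0 _)]
  have hcut : ∫ u in Ioi 0, F (t - u) * g u = ∫ u in (0 : ℝ)..t, F (t - u) * g u := by
    rw [intervalIntegral.integral_of_le ht]
    refine setIntegral_eq_of_subset_of_forall_sdiff_eq_zero measurableSet_Ioi Ioc_subset_Ioi_self ?_
    rintro u ⟨hu, hu'⟩
    have : t < u := by
      by_contra! h
      exact hu' ⟨hu, h⟩
    rw [hF, he.pseudoCDF_of_neg hlam ht j i (by linarith), zero_mul]
  have hsub : ∫ u in (0 : ℝ)..t, F (t - u) * g u =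
      ∫ s in (0 : ℝ)..t, F s * (2 * lam * Real.exp (-2 * lam * s)) := by
    have := intervalIntegral.integral_comp_sub_left (a := 0) (b := t)
      (fun s => F s * (2 * lam * Real.exp (-2 * lam * s))) t
    simpa only [sub_self, sub_zero] using this
  have hFt : F t = μ.real {ω | 0 ≤ τ ω} := by
    rw [hF, he.pseudoCDF_eq hlam ht]
    congr 1
    ext ω
    exact ⟨fun h => h.1, fun h => ⟨h, by
      have : 0 ≤ latest t j i (e ω) := h
      linarith⟩⟩
  simp only [hw]
  rw [integral_add ((integrable_const _).indicator hA) hGI, hlc, hcut, hsub,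
    integral_indicator_const _ hA, smul_eq_mul, ← hFt]

/-- The expected squared weight, as an integral against the pseudo-PDF of the age. -/
lemma integral_weight_sq (he : IsOpenSystem μ e lam sig) (hlam : 0 < lam) {t : ℝ} (ht : 0 ≤ t)
    (j i : Fin N) (hac : ∀ a b : ℝ, AbsolutelyContinuousOnInterval (pseudoCDF μ e j i t) a b) :
    ∫ ω, weight lam t j i (e ω) ^ 2 ∂μ =
      ∫ s in (0 : ℝ)..t, pseudoPDF μ e j i t s * Real.exp (-2 * lam * s) := by
  have hE : AbsolutelyContinuousOnInterval (fun s => Real.exp (-2 * lam * s)) 0 t :=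
    ContDiffOn.absolutelyContinuousOnInterval
      (by fun_prop : ContDiff ℝ 1 fun s => Real.exp (-2 * lam * s)).contDiffOn
  have hd : deriv (fun s => Real.exp (-2 * lam * s)) =
      fun s => -(2 * lam * Real.exp (-2 * lam * s)) := by
    funext s
    have h1 : HasDerivAt (fun s => -2 * lam * s) (-2 * lam * 1) s :=
      (hasDerivAt_id s).const_mul _
    rw [h1.exp.deriv]
    ring
  -- The boundary term at `t` is the mass term of `integral_weight_sq_eq_cdf`; the one at `0`
  -- vanishes by `pseudoCDF_zero`.
  have hparts := (hac 0 t).integral_mul_deriv_eq_deriv_mul hE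
  simp only [hd, mul_neg, intervalIntegral.integral_neg,
    he.pseudoCDF_zero hlam ht j i (hac _ _), zero_mul, sub_zero] at hparts
  rw [he.integral_weight_sq_eq_cdf hlam ht]
  change _ = ∫ s in (0 : ℝ)..t, deriv (pseudoCDF μ e j i t) s * Real.exp (-2 * lam * s)
  linarith

end IsOpenSystem

/-! ### The bounds at time `t` and in the limit -/

theorem mainTheorem6 {Ω : Type*} [MeasurableSpace Ω] (μ : Measure Ω) [IsProbabilityMeasure μ]
    {N : ℕ} (hN : 0 < N) (lam sig : ℝ) (hlam : 0 < lam)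
    (e : Ω → EventSequence N) (he : IsOpenSystem μ e lam sig)
    (f : ℝ → ℝ)
    (hac : ∀ i j : Fin N, i ≠ j → ∀ t : ℝ, 0 < t →
      ∀ a b : ℝ, AbsolutelyContinuousOnInterval (pseudoCDF μ e j i t) a b)
    (hf : ∀ i j : Fin N, i ≠ j → ∀ t : ℝ, 0 < t →
      ∀ᵐ s ∂(volume.restrict (Set.Ioo 0 t)), pseudoPDF μ e j i t s = f s)
    (alg : Fin N → ℝ → Set (Info N) → ℝ)
    (halg : ∀ i : Fin N, ∀ t : ℝ, 0 ≤ t →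
      @Measurable (Set (Info N)) ℝ (knowledgeSigmaAlgebra N) inferInstance (alg i t)) :
    (2 ≤ N → IntegrableOn (fun s => f s * Real.exp (-2 * lam * s)) (Set.Ioi 0)) ∧
    (∀ t : ℝ, 0 ≤ t →
      ENNReal.ofReal (((N : ℝ) - 1) / (N : ℝ) ^ 2 *
        (1 - ∫ s in (0 : ℝ)..t, f s * Real.exp (-2 * lam * s)) * sig ^ 2)
      ≤ ∫⁻ ω, ENNReal.ofReal ((e ω).mse alg t) ∂μ) ∧
    ENNReal.ofReal (((N : ℝ) - 1) / (N : ℝ) ^ 2 *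
        (1 - ∫ s in Set.Ioi (0 : ℝ), f s * Real.exp (-2 * lam * s)) * sig ^ 2)
      ≤ liminf (fun t : ℝ => ∫⁻ ω, ENNReal.ofReal ((e ω).mse alg t) ∂μ) atTop := by
  set h : ℝ → ℝ := fun s => f s * Real.exp (-2 * lam * s) with hh
  have hae : ∀ i j : Fin N, i ≠ j → ∀ t : ℝ, 0 < t → ∀ᵐ s ∂(volume.restrict (Ioc 0 t)),
      pseudoPDF μ e j i t s * Real.exp (-2 * lam * s) = h s := by
    intro i j hij t ht
    rw [← restrict_Ioo_eq_restrict_Ioc]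
    filter_upwards [hf i j hij t ht] with s hs
    rw [hs]
  have hweight : ∀ i j : Fin N, i ≠ j → ∀ t : ℝ, 0 ≤ t →
      ∫ ω, EventSequence.weight lam t j i (e ω) ^ 2 ∂μ = ∫ s in (0 : ℝ)..t, h s := by
    intro i j hij t ht
    rcases ht.eq_or_lt with rfl | ht'
    · rw [he.integral_weight_sq_zero hlam hij, intervalIntegral.integral_same]
    · rw [he.integral_weight_sq hlam ht j i (hac i j hij t ht'),
        intervalIntegral.integral_of_le ht, intervalIntegral.integral_of_le ht]
      exact integral_congr_ae (hae i j hij t ht')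
  have hbound : ∀ t : ℝ, 0 ≤ t →
      ENNReal.ofReal (((N : ℝ) - 1) / (N : ℝ) ^ 2 * (1 - ∫ s in (0 : ℝ)..t, h s) * sig ^ 2)
      ≤ ∫⁻ ω, ENNReal.ofReal ((e ω).mse alg t) ∂μ := fun t ht =>
    he.ofReal_le_lintegral_mse hN hlam ht (fun i => halg i t ht)
      fun i j hij => (hweight i j hij t ht).le
  rcases Nat.lt_or_ge N 2 with hN2 | hN2
  -- The factor `N - 1` is `0`, whatever `f` is.
  · obtain rfl : N = 1 := by omega
    refine ⟨fun h2 => absurd h2 (by norm_num), hbound, ?_⟩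
    simp
  obtain ⟨i, j, hij⟩ : ∃ i j : Fin N, i ≠ j :=
    ⟨⟨0, by omega⟩, ⟨1, by omega⟩, by simp⟩
  have hnn : ∀ t : ℝ, 0 < t → ∀ᵐ s ∂(volume.restrict (Ioc 0 t)), 0 ≤ h s := by
    intro t ht
    filter_upwards [hae i j hij t ht] with s hs
    rw [← hs]
    exact mul_nonneg (IsOpenSystem.pseudoCDF_monotone j i t).deriv_nonneg (Real.exp_pos _).le
  have hint : ∀ t : ℝ, IntegrableOn h (Ioc 0 t) := by
    intro t
    rcases le_or_gt t 0 with ht | ht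
    · simp [Ioc_eq_empty (not_lt.2 ht)]
    have h1 : IntervalIntegrable
        (fun s => pseudoPDF μ e j i t s * Real.exp (-2 * lam * s)) volume 0 t :=
      (hac i j hij t ht 0 t).intervalIntegrable_deriv.mul_continuousOn (by fun_prop)
    exact ((intervalIntegrable_iff_integrableOn_Ioc_of_le ht.le).1 h1).congr (hae i j hij t ht)
  -- The truncated integrals are second moments of weights in `[0, 1]`. With `hnn`, this bound
  -- uniform in `t` gives integrability on the half-line.
  have hle1 : ∀ t : ℝ, 0 < t → ∫ s in (0 : ℝ)..t, h s ≤ 1 := by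
    intro t ht
    rw [← hweight i j hij t ht.le]
    calc ∫ ω, EventSequence.weight lam t j i (e ω) ^ 2 ∂μ ≤ ∫ _ω, (1 : ℝ) ∂μ := by
          refine integral_mono_of_nonneg (ae_of_all _ fun _ => sq_nonneg _) (integrable_const _)
            (ae_of_all _ fun ω => ?_)
          exact pow_le_one₀ (EventSequence.weight_nonneg _ _ _ _ _)
            (EventSequence.weight_le_one hlam ht.le _ _ _)
      _ = 1 := by simp
  have hIoi : IntegrableOn h (Ioi 0) := by
    refine integrableOn_Ioi_of_intervalIntegral_norm_bounded (l := atTop) 1 0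
      (b := fun t : ℝ => t) hint tendsto_id ?_
    filter_upwards [eventually_gt_atTop 0] with t ht
    refine le_trans (le_of_eq ?_) (hle1 t ht)
    rw [intervalIntegral.integral_of_le ht.le, intervalIntegral.integral_of_le ht.le]
    refine integral_congr_ae ?_
    filter_upwards [hnn t ht] with s hs
    exact Real.norm_of_nonneg hs
  have hnnIoi : ∀ᵐ s ∂(volume.restrict (Ioi (0 : ℝ))), 0 ≤ h s := by
    have hU : Ioi (0 : ℝ) = ⋃ n : ℕ, Ioc (0 : ℝ) (n + 1) := by
      ext s
      simp only [mem_Ioi, mem_iUnion, mem_Ioc, exists_and_left]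
      refine ⟨fun hs => ⟨hs, ?_⟩, fun hs => hs.1⟩
      obtain ⟨n, hn⟩ := exists_nat_ge s
      exact ⟨n, by linarith⟩
    rw [hU, ae_restrict_iUnion_iff]
    exact fun n => hnn _ (by positivity)
  refine ⟨fun _ => hIoi, hbound, ?_⟩
  -- No convergence is needed: as `h ≥ 0` almost everywhere, the bound at each `t ≥ 0` already
  -- dominates the limiting one.
  refine le_liminf_of_le (by isBoundedDefault) ?_
  filter_upwards [eventually_ge_atTop 0] with t ht
  refine le_trans (ENNReal.ofReal_le_ofReal ?_) (hbound t ht)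
  have hmono : ∫ s in (0 : ℝ)..t, h s ≤ ∫ s in Ioi (0 : ℝ), h s := by
    rw [intervalIntegral.integral_of_le ht]
    exact setIntegral_mono_set hIoi hnnIoi (Ioc_subset_Ioi_self.eventuallyLE)
  have hN1 : (1 : ℝ) ≤ N := by exact_mod_cast hN
  gcongr
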